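/- Let $p$ be a prime. Let $G$ be a profinite group and $\chi : G \to \mathbb{Z}_p^\times$ a continuous character; for $i\in\mathbb{Z}$ let $\mathbb{Z}_p(i)$ be $\mathbb{Z}_p$ with its $p$-adic topology and $g\in G$ acting as multiplication by $\chi(g)^i$ (every free $\mathbb{Z}_p$-module of rank one with continuous $G$-action is isomorphic to such a $\mathbb{Z}_p(1)$), and put $\mathbb{F}_p(i)=\mathbb{Z}_p(i)/p$. Cohomology is continuous cohomology. The pair $(G,\mathbb{Z}_p(1))$ is called $(1,\infty)$-cyclotomic if for every open subgroup $H\subset G$ the map $H^1(H,\mathbb{Z}_p(1))\to H^1(H,\mathbb{F}_p(1))$ is surjective. An $(\mathbb{F}_p,G)$-module is a finite-dimensional $\mathbb{F}_p$-vector space $M$ with a linear action of $G$ whose kernel is open; $M(i):=M\otimes_{\mathbb{Z}_p}\mathbb{Z}_p(i)$ is $M$ with the action of $g$ multiplied by $\chi(g)^i$. The Laurent extension of $G$ is $G((t)):=\mathbb{Z}_p(1)\rtimes G$ with the product topology; $G$-modules are viewed as $G((t))$-modules through the projection $G((t))\to G$, and $(t)\in H^1(G((t)),\mathbb{Z}_p(1))$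 is the class of the $1$-cocycle $(x,g)\mapsto x$. **Proposition (Residues).** Let $(G,\mathbb{Z}_p(1))$ be a $(1,\infty)$-cyclotomic pair. Then for every integer $n\ge 1$, every $(\mathbb{F}_p,G)$-module $M$ and every $k\in\mathbb{Z}$ there is an exact sequence $$0\to H^n(G,M(k))\xrightarrow{\ \mathrm{inf}\ } H^n(G((t)),M(k))\xrightarrow{\ \partial\ } H^{n-1}(G,M(k-1))\to 0,$$ in which the first map is inflation along $G((t))\to G$. It is split by cup product with $(t)$: the map $$H^{n-1}(G,M(k-1))\to H^n(G((t)),M(k)),\qquad x\mapsto \mathrm{inf}(x)\cup (t),$$ formed with the pairing $M(k-1)\times\mathbb{Z}_p(1)\to M(k)$, $(m,a)\mapsto am$, satisfies $\partial(\mathrm{inf}(x)\cup(t))=x$ for all $x$. The sequence is natural: the maps $\partial$ can be chosen so that, whenever $(G,\mathbb{Z}_p(1))$ and $(G',\mathbb{Z}_p(1)')$ are $(1,\infty)$-cyclotomic pairs with characters $\chi,\chi'$, $\varphi:G'\to G$ is a continuous homomorphism with $\chi'=\chi\circ\varphi$, and $f:M\to M'$ is an $\mathbb{F}_p$-linear map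 from an $(\mathbb{F}_p,G)$-module to an $(\mathbb{F}_p,G')$-module with $f(\varphi(g)m)=g f(m)$, the maps $\partial$ commute with the maps in cohomology induced by $(\varphi,f)$; in particular they are natural in $M$. -/

import Mathlib

open CategoryTheory

universe u
/-! ### Cohomology classes of cocycles -/

namespace TopModuleCat

open Limits

variable {R : Type*} [Ring R] [TopologicalSpace R]

lemma surjective_of_isColimit {X Y W : TopModuleCat.{u} R} (f : X ⟶ Y) (g : W ⟶ X)
    (w : g ≫ f = 0) (h : IsColimit (CokernelCofork.ofπ f w)) :
    Function.Surjective f.hom ∧ ∀ x, f.hom x = 0 → ∃ y, g.hom y = x := by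
  let e := h.coconePointUniqueUpToIso (isColimitCoker g)
  have he : f ≫ e.hom = cokerπ g :=
    h.comp_coconePointUniqueUpToIso_hom (isColimitCoker g) WalkingParallelPair.one
  have he' : cokerπ g ≫ e.inv = f :=
    h.comp_coconePointUniqueUpToIso_inv (isColimitCoker g) WalkingParallelPair.one
  constructor
  · intro y
    obtain ⟨x, hx⟩ := cokerπ_surjective g (e.hom.hom y)
    refine ⟨x, ?_⟩
    have h1 : e.inv.hom ((cokerπ g).hom x) = f.hom x := congr($(he').hom x)
    have h2 : e.inv.hom (e.hom.hom y) = y := congr($(e.hom_inv_id).hom y)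
    rw [← h1, hx, h2]
  · intro x hx
    have h1 : e.hom.hom (f.hom x) = (cokerπ g).hom x := congr($(he).hom x)
    rw [hx, map_zero] at h1
    exact (Submodule.Quotient.mk_eq_zero _).mp h1.symm

variable (K : CochainComplex (TopModuleCat.{u} R) ℕ)

lemma iCycles_injective (n : ℕ) : Function.Injective (K.iCycles n).hom := by
  let e := (K.cyclesIsKernel n (n + 1) (by simp)).conePointUniqueUpToIso
    (isLimitKer (K.d n (n + 1)))
  have he : e.hom ≫ kerι (K.d n (n + 1)) = K.iCycles n :=
    (K.cyclesIsKernel n (n + 1) (by simp)).conePointUniqueUpToIso_hom_comp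
      (isLimitKer (K.d n (n + 1))) WalkingParallelPair.zero
  intro x y hxy
  have h1 (z) : (kerι (K.d n (n + 1))).hom (e.hom.hom z) = (K.iCycles n).hom z :=
    congr($(he).hom z)
  have h2 (z) : e.inv.hom (e.hom.hom z) = z := congr($(e.hom_inv_id).hom z)
  rw [← h2 x, ← h2 y]
  exact congrArg _ (Subtype.val_injective ((h1 x).trans (hxy.trans (h1 y).symm)))

/-- The cohomology class of an `n`-cocycle of `K`. -/
noncomputable def cls (n : ℕ) : (K.d n (n + 1)).hom.ker →+ K.homology n :=
  (K.liftCycles (kerι (K.d n (n + 1))) (n + 1) (by simp) (kerι_comp _) ≫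
    K.homologyπ n).hom.toLinearMap.toAddMonoidHom

lemma cls_eq (n : ℕ) (z : (K.d n (n + 1)).hom.ker) (y : K.cycles n)
    (h : (K.iCycles n).hom y = z) : cls K n z = (K.homologyπ n).hom y := by
  refine congrArg (K.homologyπ n).hom (iCycles_injective K n (Eq.trans ?_ h.symm))
  exact congr($(K.liftCycles_i (kerι (K.d n (n + 1))) (n + 1) (by simp) (kerι_comp _)).hom z)

lemma cls_surjective (n : ℕ) : Function.Surjective (cls K n) := by
  intro y
  obtain ⟨x, rfl⟩ := (surjective_of_isColimit _ _ _ (K.homologyIsCokernel _ n rfl)).1 y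
  have hx : (K.d n (n + 1)).hom ((K.iCycles n).hom x) = 0 :=
    congr($(K.iCycles_d n (n + 1)).hom x)
  exact ⟨⟨(K.iCycles n).hom x, hx⟩, cls_eq K n _ x rfl⟩

lemma cls_eq_zero_iff (n : ℕ) (z : (K.d n (n + 1)).hom.ker) :
    cls K n z = 0 ↔ ∃ (i : ℕ) (x : K.X i), (K.d i n).hom x = z := by
  constructor
  · intro h
    obtain ⟨y, hy⟩ := (surjective_of_isColimit _ _ _ (K.homologyIsCokernel _ n rfl)).2
      ((K.liftCycles (kerι (K.d n (n + 1))) (n + 1) (by simp) (kerι_comp _)).hom z) h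
    refine ⟨_, y, ?_⟩
    have h1 : (K.iCycles n).hom ((K.toCycles _ n).hom y) = (K.d _ n).hom y :=
      congr($(K.toCycles_i ((ComplexShape.up ℕ).prev n) n).hom y)
    rw [← h1, hy]
    exact congr($(K.liftCycles_i (kerι (K.d n (n + 1))) (n + 1) (by simp) (kerι_comp _)).hom z)
  · rintro ⟨i, x, hx⟩
    rw [cls_eq K n z ((K.toCycles i n).hom x) (Eq.trans congr($(K.toCycles_i i n).hom x) hx)]
    exact congr($(K.toCycles_comp_homologyπ i n).hom x)

end TopModuleCat

/-! ### Cup products in continuous cohomology -/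

namespace TopRep

variable {G : Type u} [Group G] [TopologicalSpace G]

/-- A continuous biadditive `G`-equivariant pairing `A × B → C` of topological `G`-modules. -/
structure Pairing (A B C : TopRep.{u} ℤ G) where
  toFun : A.V → B.V → C.V
  add_left : ∀ a a' b, toFun (a + a') b = toFun a b + toFun a' b
  add_right : ∀ a b b', toFun a (b + b') = toFun a b + toFun a b'
  equivariant : ∀ (g : G) a b, toFun (A.ρ g a) (B.ρ g b) = C.ρ g (toFun a b)
  cont : Continuous fun x : A.V × B.V => toFun x.1 x.2

variable [IsTopologicalGroup G]

/-- Transport of cochains along an equality of degrees. -/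
def castX (A : TopRep.{u} ℤ G) {i j : ℕ} (h : i = j) (x : (resolutionX A i).V) :
    (resolutionX A j).V := h ▸ x

/-- The differentials of the standard resolution, as functions. -/
def dX (A : TopRep.{u} ℤ G) (n : ℕ) (x : (resolutionX A n).V) : (resolutionX A (n + 1)).V :=
  (d A n).hom x

section

variable (A : TopRep.{u} ℤ G)

lemma dX_zero (x : A.V) : dX A 0 x = ContinuousMap.const G x := rfl

lemma dX_succ (n : ℕ) (x : (resolutionX A (n + 1)).V) (g : G) :
    (show C(G, (resolutionX A (n + 1)).V) from dX A (n + 1) x) g =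
      x - dX A n ((show C(G, (resolutionX A n).V) from x) g) := rfl

lemma dX_add (n : ℕ) (x y : (resolutionX A n).V) : dX A n (x + y) = dX A n x + dX A n y :=
  map_add _ _ _

lemma dX_sub (n : ℕ) (x y : (resolutionX A n).V) : dX A n (x - y) = dX A n x - dX A n y :=
  map_sub _ _ _

lemma castX_zero {i j : ℕ} (h : i = j) : castX A h 0 = 0 := by
  subst h; rfl

lemma castX_succ_apply {i j : ℕ} (h : i = j) (x : C(G, (resolutionX A i).V)) (g : G) :
    (show C(G, (resolutionX A j).V) from
      castX A (congrArg (· + 1) h) (show (resolutionX A (i + 1)).V from x)) g =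
      castX A h (x g) := by
  subst h; rfl

end

namespace Pairing

variable {A B C : TopRep.{u} ℤ G} (P : Pairing A B C)

/-- The pairing `A × B → C` applied to the values of elements of `C(G, …, C(G, B))`. -/
def mulX : (j : ℕ) → C(A.V × (resolutionX B j).V, (resolutionX C j).V)
  | 0 => ⟨fun x => P.toFun x.1 x.2, P.cont⟩
  | j + 1 =>
    { toFun := fun x => (mulX j).comp ((ContinuousMap.const G x.1).prodMk x.2)
      continuous_toFun :=
        (ContinuousMap.continuous_postcomp (mulX j)).comp ContinuousMap.continuous_prodMk_const }

lemma mulX_succ (j : ℕ) (a : A.V) (x : C(G, (resolutionX B j).V)) (g : G) :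
    (show C(G, (resolutionX C j).V) from P.mulX (j + 1) (a, x)) g = P.mulX j (a, x g) := rfl

lemma mulX_add_left (j : ℕ) (a a' : A.V) (x : (resolutionX B j).V) :
    P.mulX j (a + a', x) = P.mulX j (a, x) + P.mulX j (a', x) := by
  induction j with
  | zero => exact P.add_left a a' x
  | succ j ih => exact ContinuousMap.ext fun g => ih ((show C(G, (resolutionX B j).V) from x) g)

lemma mulX_add_right (j : ℕ) (a : A.V) (x y : (resolutionX B j).V) :
    P.mulX j (a, x + y) = P.mulX j (a, x) + P.mulX j (a, y) := by
  induction j with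
  | zero => exact P.add_right a x y
  | succ j ih =>
    exact ContinuousMap.ext fun g => ih ((show C(G, (resolutionX B j).V) from x) g)
      ((show C(G, (resolutionX B j).V) from y) g)

lemma mulX_equivariant (j : ℕ) (g : G) (a : A.V) (x : (resolutionX B j).V) :
    P.mulX j (A.ρ g a, (resolutionX B j).ρ g x) = (resolutionX C j).ρ g (P.mulX j (a, x)) := by
  induction j with
  | zero => exact P.equivariant g a x
  | succ j ih =>
    exact ContinuousMap.ext fun h => ih ((show C(G, (resolutionX B j).V) from x) (g⁻¹ * h))

lemma mulX_sub_left (j : ℕ) (a a' : A.V) (x : (resolutionX B j).V) :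
    P.mulX j (a - a', x) = P.mulX j (a, x) - P.mulX j (a', x) := by
  rw [eq_sub_iff_add_eq, ← mulX_add_left, sub_add_cancel]

lemma mulX_sub_right (j : ℕ) (a : A.V) (x y : (resolutionX B j).V) :
    P.mulX j (a, x - y) = P.mulX j (a, x) - P.mulX j (a, y) := by
  rw [eq_sub_iff_add_eq, ← mulX_add_right, sub_add_cancel]

lemma mulX_dX (j : ℕ) (a : A.V) (x : (resolutionX B j).V) :
    P.mulX (j + 1) (a, dX B j x) = dX C j (P.mulX j (a, x)) := by
  induction j with
  | zero => rfl
  | succ j ih =>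
    refine ContinuousMap.ext fun g => ?_
    rw [dX_succ]
    refine (P.mulX_sub_right (j + 1) a x _).trans ?_
    exact congrArg (P.mulX (j + 1) (a, x) - ·) (ih ((show C(G, (resolutionX B j).V) from x) g))

variable [LocallyCompactSpace G]

/-- The cup product of (not necessarily invariant) homogeneous cochains `F` of degree `n` with
values in `A` and `E` of degree `j` with values in `B`:
`(F ∪ E)(g₀, …, gₙ, h₁, …, hⱼ) = F(g₀, …, gₙ) · E(gₙ, h₁, …, hⱼ)`. -/
def cupX {j : ℕ} (E : (resolutionX B (j + 1)).V) :
    (n : ℕ) → C((resolutionX A (n + 1)).V, (resolutionX C (j + n + 1)).V)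
  | 0 =>
    { toFun := fun F => (P.mulX j).comp (ContinuousMap.prodMk F E)
      continuous_toFun := by
        refine ContinuousMap.continuous_of_continuous_uncurry _ ?_
        exact (P.mulX j).continuous.comp (continuous_eval.prodMk
          ((show C(G, (resolutionX B j).V) from E).continuous.comp continuous_snd)) }
  | n + 1 =>
    { toFun := fun F => (cupX E n).comp F
      continuous_toFun := ContinuousMap.continuous_postcomp _ }

lemma cupX_zero_apply {j : ℕ} (E : C(G, (resolutionX B j).V)) (F : C(G, A.V)) (g : G) :
    (show C(G, (resolutionX C j).V) from P.cupX (j := j) E 0 F) g = P.mulX j (F g, E g) := rfl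

lemma cupX_succ_apply {j n : ℕ} (E : (resolutionX B (j + 1)).V)
    (F : C(G, (resolutionX A (n + 1)).V)) (g : G) :
    (show C(G, (resolutionX C (j + n + 1)).V) from P.cupX E (n + 1) F) g =
      P.cupX E n (F g) := rfl

lemma cupX_add_left {j : ℕ} (E : (resolutionX B (j + 1)).V) (n : ℕ)
    (F F' : (resolutionX A (n + 1)).V) :
    P.cupX E n (F + F') = P.cupX E n F + P.cupX E n F' := by
  induction n with
  | zero => exact ContinuousMap.ext fun g => P.mulX_add_left j _ _ _
  | succ n ih => exact ContinuousMap.ext fun g => ih _ _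

lemma cupX_sub_left {j : ℕ} (E : (resolutionX B (j + 1)).V) (n : ℕ)
    (F F' : (resolutionX A (n + 1)).V) :
    P.cupX E n (F - F') = P.cupX E n F - P.cupX E n F' := by
  rw [eq_sub_iff_add_eq, ← cupX_add_left, sub_add_cancel]

lemma cupX_add_right {j : ℕ} (E E' : (resolutionX B (j + 1)).V) (n : ℕ)
    (F : (resolutionX A (n + 1)).V) :
    P.cupX (E + E') n F = P.cupX E n F + P.cupX E' n F := by
  induction n with
  | zero => exact ContinuousMap.ext fun g => P.mulX_add_right j _ _ _
  | succ n ih => exact ContinuousMap.ext fun g => ih _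

lemma cupX_zero_left {j : ℕ} (E : (resolutionX B (j + 1)).V) (n : ℕ) : P.cupX E n 0 = 0 := by
  have h := P.cupX_sub_left E n 0 0
  rwa [sub_self, sub_self] at h

lemma cupX_zero_right {j : ℕ} (n : ℕ) (F : (resolutionX A (n + 1)).V) :
    P.cupX (0 : (resolutionX B (j + 1)).V) n F = 0 := by
  have h := P.cupX_add_right (0 : (resolutionX B (j + 1)).V) 0 n F
  rwa [add_zero, left_eq_add] at h

lemma cupX_equivariant {j : ℕ} (E : (resolutionX B (j + 1)).V) (n : ℕ)
    (F : (resolutionX A (n + 1)).V) (g : G) :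
    P.cupX ((resolutionX B (j + 1)).ρ g E) n ((resolutionX A (n + 1)).ρ g F) =
      (resolutionX C (j + n + 1)).ρ g (P.cupX E n F) := by
  induction n with
  | zero => exact ContinuousMap.ext fun h => P.mulX_equivariant j g _ _
  | succ n ih =>
    exact ContinuousMap.ext fun h => ih ((show C(G, (resolutionX A (n + 1)).V) from F) (g⁻¹ * h))

/-- The Leibniz rule `d(F ∪ E) = dF ∪ E + (-1)ⁿ F ∪ dE`. -/
lemma dX_cupX {j : ℕ} (E : (resolutionX B (j + 1)).V) (n : ℕ)
    (F : (resolutionX A (n + 1)).V) :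
    dX C (j + n + 1) (P.cupX E n F) = P.cupX E (n + 1) (dX A (n + 1) F) +
      (-1 : ℤ) ^ n • castX C (by omega) (P.cupX (dX B (j + 1) E) n F) := by
  induction n with
  | zero =>
    refine ContinuousMap.ext fun g => ?_
    change P.cupX E 0 F - dX C j (P.mulX j ((show C(G, A.V) from F) g,
        (show C(G, (resolutionX B j).V) from E) g)) =
      P.cupX E 0 (F - dX A 0 ((show C(G, A.V) from F) g)) +
        (1 : ℤ) • P.mulX (j + 1) ((show C(G, A.V) from F) g,
          E - dX B j ((show C(G, (resolutionX B j).V) from E) g))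
    rw [cupX_sub_left, mulX_sub_right, mulX_dX, one_smul]
    change P.cupX E 0 F - dX C j (P.mulX j ((show C(G, A.V) from F) g,
        (show C(G, (resolutionX B j).V) from E) g)) =
      P.cupX E 0 F - P.mulX (j + 1) ((show C(G, A.V) from F) g, E) + _
    abel
  | succ n ih =>
    refine ContinuousMap.ext fun g => ?_
    have hc := castX_succ_apply C (i := j + 1 + n + 1) (j := j + n + 1 + 1) (by omega)
      (P.cupX (dX B (j + 1) E) (n + 1) F) g
    change P.cupX E (n + 1) F - dX C (j + n + 1)
        (P.cupX E n ((show C(G, (resolutionX A (n + 1)).V) from F) g)) =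
      P.cupX E (n + 1) (F - dX A (n + 1) ((show C(G, (resolutionX A (n + 1)).V) from F) g)) +
        (-1 : ℤ) ^ (n + 1) • _
    rw [ih, cupX_sub_left]
    refine Eq.trans ?_ (congrArg (fun z => P.cupX E (n + 1) F - P.cupX E (n + 1)
      (dX A (n + 1) ((show C(G, (resolutionX A (n + 1)).V) from F) g)) +
        (-1 : ℤ) ^ (n + 1) • z) hc.symm)
    rw [pow_succ, mul_neg_one, neg_smul, sub_add_eq_sub_sub, sub_eq_add_neg _ (_ • _)]
    rfl

end Pairing
end TopRep

namespace TopRep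

variable {G : Type u} [Group G] [TopologicalSpace G] [IsTopologicalGroup G]

/-- The group of homogeneous `n`-cocycles. -/
abbrev Cocycle (A : TopRep.{u} ℤ G) (n : ℕ) : Type u :=
  ((homogeneousCochains A).d n (n + 1)).hom.ker

/-- The class of a homogeneous cocycle in continuous cohomology. -/
noncomputable abbrev cocycleClass (A : TopRep.{u} ℤ G) (n : ℕ) :
    Cocycle A n →+ continuousCohomology n A :=
  TopModuleCat.cls (homogeneousCochains A) n

lemma mem_cocycle_iff {A : TopRep.{u} ℤ G} {n : ℕ} (F : (homogeneousCochains A).X n) :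
    F ∈ ((homogeneousCochains A).d n (n + 1)).hom.ker ↔ dX A (n + 1) F.1 = 0 := by
  rw [← homogeneousCochains.d_apply A n F |> fun h => (show _ = dX A (n + 1) F.1 from h)]
  exact Subtype.ext_iff

lemma exists_d_castX (C : TopRep.{u} ℤ G) {m m' : ℕ} (h : m' = m + 1)
    (z : (homogeneousCochains C).X m') (w : (homogeneousCochains C).X m)
    (hw : castX C (congrArg (· + 1) h) z.1 = dX C (m + 1) w.1) :
    ((homogeneousCochains C).d m m').hom w = z := by
  subst h
  exact Subtype.ext ((homogeneousCochains.d_apply C m w).trans hw.symm)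

namespace Pairing

variable {A B C : TopRep.{u} ℤ G} (P : Pairing A B C) [LocallyCompactSpace G] {n j : ℕ}

/-- The cup product of homogeneous cochains. -/
def cupCochain (F : (homogeneousCochains A).X n) (E : (homogeneousCochains B).X j) :
    (homogeneousCochains C).X (j + n) :=
  ⟨P.cupX E.1 n F.1, fun g => by
    have h := P.cupX_equivariant E.1 n F.1 g
    rw [E.2 g, F.2 g] at h
    exact h.symm⟩

lemma d_cupCochain (F : Cocycle A n) (E : Cocycle B j) :
    P.cupCochain F.1 E.1 ∈ ((homogeneousCochains C).d (j + n) (j + n + 1)).hom.ker := by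
  rw [mem_cocycle_iff]
  have hF := (mem_cocycle_iff F.1).1 F.2
  have hE := (mem_cocycle_iff E.1).1 E.2
  refine (P.dX_cupX E.1.1 n F.1.1).trans ?_
  have h1 : P.cupX E.1.1 (n + 1) (dX A (n + 1) F.1.1) = 0 := by
    rw [hF]
    exact P.cupX_zero_left E.1.1 (n + 1)
  have h2 : P.cupX (dX B (j + 1) E.1.1) n F.1.1 = 0 := by
    rw [hE]
    exact P.cupX_zero_right n F.1.1
  rw [h1, h2, zero_add, castX_zero, smul_zero]

/-- The cup product of homogeneous cocycles. -/
def cupCocycle (F : Cocycle A n) (E : Cocycle B j) : Cocycle C (j + n) :=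
  ⟨P.cupCochain F.1 E.1, P.d_cupCochain F E⟩

lemma cls_cupCocycle_left (F : Cocycle A n) (E : Cocycle B j) (hF : cocycleClass A n F = 0) :
    cocycleClass C (j + n) (P.cupCocycle F E) = 0 := by
  obtain ⟨i, F', hF'⟩ := (TopModuleCat.cls_eq_zero_iff _ _ _).1 hF
  by_cases hi : i + 1 = n
  swap
  · have h0 : F = 0 := by
      refine Subtype.ext (hF'.symm.trans ?_)
      rw [(homogeneousCochains A).shape i n hi]; rfl
    subst h0
    refine (congrArg (cocycleClass C (j + n)) (Subtype.ext (Subtype.ext ?_))).trans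
      (map_zero (cocycleClass C (j + n)))
    exact P.cupX_zero_left E.1.1 n
  subst hi
  refine (TopModuleCat.cls_eq_zero_iff _ _ _).2 ⟨j + i, P.cupCochain F' E.1, Subtype.ext ?_⟩
  refine (homogeneousCochains.d_apply C (j + i) _).trans ?_
  refine (P.dX_cupX E.1.1 i F'.1).trans ?_
  have hE := (mem_cocycle_iff E.1).1 E.2
  have h2 : P.cupX (dX B (j + 1) E.1.1) i F'.1 = 0 := by
    rw [hE]
    exact P.cupX_zero_right i F'.1
  rw [h2, castX_zero, smul_zero, add_zero]
  refine congrArg (P.cupX E.1.1 (i + 1)) ?_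
  exact (homogeneousCochains.d_apply A i F').symm.trans congr(($hF').1)

lemma cls_cupCocycle_right (F : Cocycle A n) (E : Cocycle B j) (hE : cocycleClass B j E = 0) :
    cocycleClass C (j + n) (P.cupCocycle F E) = 0 := by
  obtain ⟨i, E', hE'⟩ := (TopModuleCat.cls_eq_zero_iff _ _ _).1 hE
  by_cases hi : i + 1 = j
  swap
  · have h0 : E = 0 := by
      refine Subtype.ext (hE'.symm.trans ?_)
      rw [(homogeneousCochains B).shape i j hi]; rfl
    subst h0
    refine (congrArg (cocycleClass C (j + n)) (Subtype.ext (Subtype.ext ?_))).trans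
      (map_zero (cocycleClass C (j + n)))
    exact P.cupX_zero_right n F.1.1
  subst hi
  refine (TopModuleCat.cls_eq_zero_iff _ _ _).2
    ⟨i + n, (-1 : ℤ) ^ n • P.cupCochain F.1 E', exists_d_castX C (by omega) _ _ ?_⟩
  have hF := (mem_cocycle_iff F.1).1 F.2
  have h1 : P.cupX E'.1 (n + 1) (dX A (n + 1) F.1.1) = 0 := by
    rw [hF]
    exact P.cupX_zero_left E'.1 (n + 1)
  have h2 := P.dX_cupX E'.1 n F.1.1
  rw [h1, zero_add] at h2
  have h3 : dX B (i + 1) E'.1 = E.1.1 :=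
    (homogeneousCochains.d_apply B i E').symm.trans congr(($hE').1)
  rw [h3] at h2
  have h4 : dX C (i + n + 1) ((-1 : ℤ) ^ n • P.cupX E'.1 n F.1.1) =
      (-1 : ℤ) ^ n • dX C (i + n + 1) (P.cupX E'.1 n F.1.1) := map_zsmul _ _ _
  refine Eq.trans ?_ h4.symm
  rw [h2, smul_smul, ← mul_pow]
  simp only [neg_mul, one_mul, neg_neg, one_pow, one_smul]
  rfl

/-- The cup product of cocycles, with values in cohomology. -/
noncomputable def cupHom (n j : ℕ) : Cocycle A n →+ Cocycle B j →+ continuousCohomology (j + n) C :=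
  AddMonoidHom.mk' (fun F => AddMonoidHom.mk'
    (fun E => cocycleClass C (j + n) (P.cupCocycle F E))
    (fun E E' => by
      rw [← map_add]
      exact congrArg _ (Subtype.ext (Subtype.ext (P.cupX_add_right E.1.1 E'.1.1 n F.1.1)))))
    (fun F F' => AddMonoidHom.ext fun E => by
      refine Eq.trans ?_ (map_add (cocycleClass C (j + n)) (P.cupCocycle F E) (P.cupCocycle F' E))
      exact congrArg (cocycleClass C (j + n)) (a₁ := P.cupCocycle (F + F') E)
        (a₂ := P.cupCocycle F E + P.cupCocycle F' E)
        (Subtype.ext (Subtype.ext (P.cupX_add_left E.1.1 n F.1.1 F'.1.1))))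

/-- The cup product `Hⁿ(G, A) × Hʲ(G, B) → Hⁿ⁺ʲ(G, C)` in continuous cohomology. -/
noncomputable def cup (n j : ℕ) :
    continuousCohomology n A →+ continuousCohomology j B →+ continuousCohomology (j + n) C :=
  (cocycleClass A n).liftOfSurjective (TopModuleCat.cls_surjective _ n)
    ⟨AddMonoidHom.mk' (fun F => (cocycleClass B j).liftOfSurjective
        (TopModuleCat.cls_surjective _ j)
        ⟨P.cupHom n j F, fun E hE => P.cls_cupCocycle_right F E hE⟩)
      (fun F F' => AddMonoidHom.ext fun y => by
        obtain ⟨E, rfl⟩ := TopModuleCat.cls_surjective _ j y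
        simp only [AddMonoidHom.liftOfSurjective, AddMonoidHom.liftOfRightInverse_comp_apply,
          AddMonoidHom.add_apply, map_add]),
    fun F hF => AddMonoidHom.ext fun y => by
      obtain ⟨E, rfl⟩ := TopModuleCat.cls_surjective _ j y
      refine (AddMonoidHom.liftOfRightInverse_comp_apply _ _ _ _ _).trans ?_
      exact P.cls_cupCocycle_left F E hF⟩

lemma cup_cls (F : Cocycle A n) (E : Cocycle B j) :
    P.cup n j (cocycleClass A n F) (cocycleClass B j E) =
      cocycleClass C (j + n) (P.cupCocycle F E) := by
  refine (DFunLike.congr_fun (AddMonoidHom.liftOfRightInverse_comp_apply _ _ _ _ _) _).trans ?_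
  exact AddMonoidHom.liftOfRightInverse_comp_apply _ _ _ _ _

end Pairing
end TopRep

namespace TopRep

/-- The pairing of `H`-modules obtained by restriction along a homomorphism `φ : H → G`. -/
def Pairing.res {G H : Type u} [Group G] [TopologicalSpace G] [IsTopologicalGroup G]
    [Group H] [TopologicalSpace H] [IsTopologicalGroup H] {A B C : TopRep.{u} ℤ G}
    (P : Pairing A B C) (φ : H →ₜ* G) :
    Pairing (TopRep.res (φ : H →* G) A) (TopRep.res (φ : H →* G) B)
      (TopRep.res (φ : H →* G) C) where
  toFun := P.toFun
  add_left := P.add_left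
  add_right := P.add_right
  equivariant h := P.equivariant (φ h)
  cont := P.cont

/-- The homogeneous `1`-cocycle `(g, h) ↦ g • c (g⁻¹ * h) = c h - c g` attached to a continuous
(inhomogeneous) `1`-cocycle `c`. -/
def Cocycle.ofCrossedHom {G : Type u} [Group G] [TopologicalSpace G] [IsTopologicalGroup G]
    (A : TopRep.{u} ℤ G) (c : C(G, A.V)) (hc : ∀ g h, c (g * h) = c g + A.ρ g (c h)) :
    Cocycle A 1 :=
  ⟨⟨ContinuousMap.curry (X := G) (Y := G) (Z := A.V) ⟨fun x => c x.2 - c x.1, by fun_prop⟩,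
    fun g => ContinuousMap.ext fun x => ContinuousMap.ext fun y => by
      change A.ρ g (c (g⁻¹ * y) - c (g⁻¹ * x)) = c y - c x
      have h (z : G) : c z = c g + A.ρ g (c (g⁻¹ * z)) := by rw [← hc, mul_inv_cancel_left]
      rw [h x, h y, map_sub]; abel⟩, by
    refine (mem_cocycle_iff _).2 ?_
    refine ContinuousMap.ext fun x => ContinuousMap.ext fun y => ContinuousMap.ext fun z => ?_
    change (c z - c y) - ((c z - c x) - (c y - c x)) = 0
    abel⟩

end TopRep

/-! ### Cyclotomic pairs -/

section Cyclotomic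

variable {p : ℕ} [Fact p.Prime] {G : Type u} [Group G] [TopologicalSpace G]

/-- `ℤ_p(i)`: the group `ℤ_p` with its `p`-adic topology, on which `g` acts as `χ(g)ⁱ`. -/
noncomputable def zpTwist (χ : G →ₜ* ℤ_[p]ˣ) (i : ℤ) : TopRep.{u} ℤ G :=
  TopRep.of (X := ULift.{u} ℤ_[p]) (ContRepresentation.ofMonoidHom
    { toFun := fun g =>
        { toFun := fun x => ⟨((χ g ^ i : ℤ_[p]ˣ) : ℤ_[p]) * x.down⟩
          map_add' := fun x y => ULift.ext _ _ (mul_add _ _ _)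
          map_smul' := fun m x => ULift.ext _ _ (mul_smul_comm m _ _)
          cont := continuous_uliftUp.comp (continuous_const.mul continuous_uliftDown) }
      map_one' := by ext x; simp
      map_mul' := fun g h => by ext x; simp [mul_zpow, mul_assoc] })

variable (p G) in
/-- An `(𝔽_p, G)`-module: a finite-dimensional `𝔽_p`-vector space with a linear action of `G` whose
kernel is open. -/
structure FpModule where
  V : Type u
  [addCommGroup : AddCommGroup V]
  [module : Module (ZMod p) V]
  [finite : Module.Finite (ZMod p) V]
  ρ : Representation (ZMod p) G V
  isOpen_ker : IsOpen (ρ.ker : Set G)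

namespace FpModule

attribute [instance] addCommGroup module finite

instance (M : FpModule p G) : TopologicalSpace M.V := ⊥

instance (M : FpModule p G) : DiscreteTopology M.V := ⟨rfl⟩

/-- The reduction modulo `p` of the `i`-th power of the character `χ`. -/
noncomputable def modChar (χ : G →ₜ* ℤ_[p]ˣ) (i : ℤ) (g : G) : ZMod p :=
  ((Units.map (PadicInt.toZMod (p := p)).toMonoidHom (χ g) ^ i : (ZMod p)ˣ) : ZMod p)

/-- The cyclotomic twist `M(i) = M ⊗ ℤ_p(i)`: the discrete group `M`, on which the action of `g` is
multiplied by `χ(g)ⁱ`. -/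
noncomputable def twist (M : FpModule.{u} p G) (χ : G →ₜ* ℤ_[p]ˣ) (i : ℤ) : TopRep.{u} ℤ G :=
  TopRep.of (X := M.V) (ContRepresentation.ofMonoidHom
    { toFun := fun g =>
        { toFun := fun m => modChar χ i g • M.ρ g m
          map_add' := fun x y => by simp
          map_smul' := fun n x => by
            rw [map_zsmul]; exact smul_comm _ _ _
          cont := continuous_of_discreteTopology }
      map_one' := by ext x; simp [modChar]
      map_mul' := fun g h => by ext x; simp [modChar, mul_zpow, mul_smul] })

variable (p G) in
/-- The trivial module `𝔽_p`. -/
def fp : FpModule.{u} p G where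
  V := ULift.{u} (ZMod p)
  ρ := 1
  isOpen_ker := by
    have : ((1 : Representation (ZMod p) G (ULift.{u} (ZMod p))).ker : Set G) = Set.univ := by
      ext g; simp
    rw [this]; exact isOpen_univ

end FpModule

lemma continuous_toZMod : Continuous (PadicInt.toZMod (p := p)) := by
  refine continuous_of_continuousAt_zero (PadicInt.toZMod (p := p)) ?_
  rw [ContinuousAt, map_zero, nhds_discrete (ZMod p), Filter.tendsto_pure]
  filter_upwards [Metric.ball_mem_nhds (0 : ℤ_[p]) one_pos] with x hx
  rw [← RingHom.mem_ker, PadicInt.ker_toZMod, IsLocalRing.mem_maximalIdeal, PadicInt.mem_nonunits]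
  simpa using hx

lemma FpModule.modChar_eq (χ : G →ₜ* ℤ_[p]ˣ) (i : ℤ) (g : G) :
    FpModule.modChar χ i g = PadicInt.toZMod ((χ g ^ i : ℤ_[p]ˣ) : ℤ_[p]) := by
  rw [FpModule.modChar, ← map_zpow]; rfl

/-- The reduction map `ℤ_p(i) → 𝔽_p(i)`. -/
noncomputable def reduceTwist (χ : G →ₜ* ℤ_[p]ˣ) (i : ℤ) :
    zpTwist χ i ⟶ (FpModule.fp p G).twist χ i :=
  TopRep.ofHom
    { toFun := fun x => ⟨PadicInt.toZMod x.down⟩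
      map_add' := fun x y => ULift.ext _ _ (map_add _ _ _)
      map_smul' := fun n x => ULift.ext _ _ (map_zsmul _ n _)
      cont := by
        have h : Continuous (Y := (FpModule.fp.{u} p G).V) fun x : ZMod p => ULift.up x :=
          continuous_of_discreteTopology
        exact h.comp (continuous_toZMod.comp continuous_uliftDown)
      isIntertwining' := fun g => by
        ext x
        refine ULift.ext _ _ ?_
        change PadicInt.toZMod (_ * x.down) = FpModule.modChar χ i g * PadicInt.toZMod x.down
        rw [map_mul, FpModule.modChar_eq] }

/-- The restriction of a character to a subgroup. -/
noncomputable def restrictChar (χ : G →ₜ* ℤ_[p]ˣ) (H : Subgroup G) : H →ₜ* ℤ_[p]ˣ where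
  toMonoidHom := (χ : G →* ℤ_[p]ˣ).comp H.subtype
  continuous_toFun := χ.continuous_toFun.comp continuous_subtype_val

/-- The map `Hᵐ(G, ℤ_p(i)) → Hᵐ(G, 𝔽_p(i))` induced by reduction. -/
noncomputable def reduceCoh [IsTopologicalGroup G] (χ : G →ₜ* ℤ_[p]ˣ) (i : ℤ) (m : ℕ) :
    continuousCohomology m (zpTwist.{u} χ i) →+
      continuousCohomology m ((FpModule.fp.{u} p G).twist χ i) :=
  (ContinuousCohomology.map (X := zpTwist.{u} χ i) (ContinuousMonoidHom.id G)
    (reduceTwist.{u} χ i) m).hom.toAddMonoidHom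

/-- `(G, ℤ_p(1))` is `(n, ∞)`-cyclotomic: `Hⁿ(H, ℤ_p(n)) → Hⁿ(H, 𝔽_p(n))` is surjective for every
open subgroup `H` of `G`. -/
def IsCyclotomic [IsTopologicalGroup G] (n : ℕ) (χ : G →ₜ* ℤ_[p]ˣ) : Prop :=
  ∀ H : Subgroup G, IsOpen (H : Set G) →
    Function.Surjective (reduceCoh (restrictChar χ H) n n)

/-- The pairing `M(k - 1) × ℤ_p(1) → M(k)`, `(m, x) ↦ x m`. -/
noncomputable def FpModule.twistPairing [IsTopologicalGroup G] (M : FpModule.{u} p G) (χ : G →ₜ* ℤ_[p]ˣ) (k : ℤ) :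
    TopRep.Pairing (M.twist χ (k - 1)) (zpTwist χ 1) (M.twist χ k) where
  toFun := fun (m : M.V) x => (PadicInt.toZMod x.down • m : M.V)
  add_left := fun (m m' : M.V) x => smul_add (PadicInt.toZMod x.down) m m'
  add_right := fun (m : M.V) x y => by
    refine Eq.trans ?_ (add_smul (PadicInt.toZMod x.down) (PadicInt.toZMod y.down) m)
    exact congrArg (fun z : ZMod p => z • m) (map_add PadicInt.toZMod x.down y.down)
  equivariant g m x := by
    change PadicInt.toZMod (((χ g ^ (1 : ℤ) : ℤ_[p]ˣ) : ℤ_[p]) * x.down) •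
      (modChar χ (k - 1) g • M.ρ g (show M.V from m)) =
      modChar χ k g • M.ρ g (PadicInt.toZMod x.down • (show M.V from m))
    rw [map_mul, ← modChar_eq, map_smul, smul_smul, smul_smul]
    congr 1
    have h : modChar χ k g = modChar χ (k - 1) g * modChar χ 1 g := by
      rw [modChar, modChar, modChar, ← Units.val_mul, ← zpow_add, sub_add_cancel]
    rw [h]; ring
  cont := by
    have h : Continuous fun y : ZMod p × M.V => y.1 • y.2 := continuous_of_discreteTopology
    exact h.comp (((continuous_toZMod (p := p)).comp
      (continuous_uliftDown.comp continuous_snd)).prodMk continuous_fst)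

end Cyclotomic

/-! ### Laurent extensions -/

section Laurent

variable {p : ℕ} [Fact p.Prime] {G : Type u} [Group G] [TopologicalSpace G]

/-- The action of `G` on the (multiplicatively written) group `ℤ_p(1)`. -/
noncomputable def laurentAction (χ : G →ₜ* ℤ_[p]ˣ) : G →* MulAut (Multiplicative ℤ_[p]) :=
  ((MulAutMultiplicative ℤ_[p]).symm.toMonoidHom.comp
    (DistribMulAction.toAddAut ℤ_[p]ˣ ℤ_[p])).comp (χ : G →* ℤ_[p]ˣ)

/-- The Laurent extension `G((t)) = ℤ_p(1) ⋊ G`. -/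
def LaurentExt (χ : G →ₜ* ℤ_[p]ˣ) : Type u :=
  Multiplicative ℤ_[p] ⋊[laurentAction χ] G

namespace LaurentExt

variable (χ : G →ₜ* ℤ_[p]ˣ)

noncomputable instance : Group (LaurentExt χ) :=
  inferInstanceAs (Group (Multiplicative ℤ_[p] ⋊[laurentAction χ] G))

variable {χ} in
/-- The component in `ℤ_p(1)` of an element of `G((t))`. -/
noncomputable def coord (a : LaurentExt χ) : ℤ_[p] := Multiplicative.toAdd (SemidirectProduct.left a)

variable {χ} in
/-- The component in `G` of an element of `G((t))`. -/
def base (a : LaurentExt χ) : G := SemidirectProduct.right a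

/-- The underlying set of `G((t))` is `ℤ_p × G`. -/
noncomputable def equivProd : LaurentExt χ ≃ ℤ_[p] × G where
  toFun a := (a.coord, a.base)
  invFun x := ⟨Multiplicative.ofAdd x.1, x.2⟩
  left_inv _ := rfl
  right_inv _ := rfl

/-- `G((t))` carries the product topology. -/
noncomputable instance : TopologicalSpace (LaurentExt χ) := .induced (equivProd χ) inferInstance

/-- `G((t))` is homeomorphic to `ℤ_p × G`. -/
noncomputable def homeo : LaurentExt χ ≃ₜ ℤ_[p] × G := (equivProd χ).toHomeomorphOfIsInducing ⟨rfl⟩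

variable {χ}

lemma continuous_coord : Continuous (coord : LaurentExt χ → ℤ_[p]) :=
  continuous_fst.comp (homeo χ).continuous

lemma continuous_base : Continuous (base : LaurentExt χ → G) :=
  continuous_snd.comp (homeo χ).continuous

lemma base_mul (a b : LaurentExt χ) : (a * b).base = a.base * b.base := rfl

lemma base_inv (a : LaurentExt χ) : a⁻¹.base = a.base⁻¹ := rfl

lemma coord_mul (a b : LaurentExt χ) :
    (a * b).coord = a.coord + (χ a.base : ℤ_[p]) * b.coord := rfl

lemma coord_inv (a : LaurentExt χ) :
    a⁻¹.coord = ((χ a.base)⁻¹ : ℤ_[p]ˣ) * (-a.coord) := by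
  rw [← map_inv]; rfl

lemma continuous_iff {X : Type*} [TopologicalSpace X] {f : X → LaurentExt χ} :
    Continuous f ↔ Continuous (fun x => (f x).coord) ∧ Continuous fun x => (f x).base :=
  (homeo χ).comp_continuous_iff.symm.trans continuous_prodMk

instance [IsTopologicalGroup G] : IsTopologicalGroup (LaurentExt χ) where
  continuous_mul := continuous_iff.2
    ⟨(continuous_coord.comp continuous_fst).add ((Units.continuous_val.comp
      (χ.continuous_toFun.comp (continuous_base.comp continuous_fst))).mul
        (continuous_coord.comp continuous_snd)),
      (continuous_base.comp continuous_fst).mul (continuous_base.comp continuous_snd)⟩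
  continuous_inv := by
    refine continuous_iff.2 ⟨?_, continuous_base.inv⟩
    simp only [coord_inv]
    exact (Units.continuous_val.comp
      (χ.continuous_toFun.comp continuous_base).inv).mul continuous_coord.neg

instance [CompactSpace G] : CompactSpace (LaurentExt χ) := (homeo χ).symm.compactSpace

instance [TotallyDisconnectedSpace G] : TotallyDisconnectedSpace (LaurentExt χ) :=
  (homeo χ).symm.totallyDisconnectedSpace

variable (χ) in
/-- The projection `π : G((t)) → G`. -/
noncomputable def proj : LaurentExt χ →ₜ* G where
  toFun := base
  map_one' := rfl
  map_mul' := base_mul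
  continuous_toFun := continuous_base

variable (χ) in
/-- The class `(t) ∈ H¹(G((t)), ℤ_p(1))` of the cocycle `(x, g) ↦ x`. -/
noncomputable def tClass [IsTopologicalGroup G] :
    continuousCohomology 1 (TopRep.res (proj χ : LaurentExt χ →* G) (zpTwist χ 1)) :=
  TopRep.cocycleClass _ 1 (TopRep.Cocycle.ofCrossedHom _
    ⟨fun a => ULift.up a.coord, continuous_uliftUp.comp continuous_coord⟩
    (fun a b => ULift.ext _ _ (by
      change (a * b).coord = a.coord + ((χ a.base ^ (1 : ℤ) : ℤ_[p]ˣ) : ℤ_[p]) * b.coord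
      rw [zpow_one, coord_mul])))

/-- The homomorphism `G'((t)) → G((t))`, `(x, g) ↦ (x, φ g)`, induced by `φ : G' → G`, if `χ'` is the
pullback of `χ`. -/
noncomputable def map {G' : Type u} [Group G'] [TopologicalSpace G']
    {χ' : G' →ₜ* ℤ_[p]ˣ} (φ : G' →ₜ* G) (hφ : ∀ g, χ (φ g) = χ' g) :
    LaurentExt χ' →ₜ* LaurentExt χ where
  toFun a := (equivProd χ).symm (a.coord, φ a.base)
  map_one' := (equivProd χ).injective (Prod.ext rfl (map_one φ))
  map_mul' a b := (equivProd χ).injective (Prod.ext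
    (by
      change (a * b).coord = a.coord + (χ (φ a.base) : ℤ_[p]) * b.coord
      rw [coord_mul, hφ])
    (map_mul φ a.base b.base))
  continuous_toFun := continuous_iff.2
    ⟨continuous_coord, φ.continuous_toFun.comp continuous_base⟩

end LaurentExt

namespace FpModule

variable [IsTopologicalGroup G] (M : FpModule.{u} p G) (χ : G →ₜ* ℤ_[p]ˣ) (k : ℤ)

/-- `M(k)` as a `G((t))`-module, through the projection `G((t)) → G`. -/
noncomputable abbrev laurentTwist : TopRep.{u} ℤ (LaurentExt χ) :=
  TopRep.res (LaurentExt.proj χ : LaurentExt χ →* G) (M.twist χ k)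

/-- The inflation map `Hⁿ(G, M(k)) → Hⁿ(G((t)), M(k))`. -/
noncomputable def infl (n : ℕ) :
    continuousCohomology n (M.twist χ k) →+ continuousCohomology n (M.laurentTwist χ k) :=
  (ContinuousCohomology.map (LaurentExt.proj χ) (𝟙 (M.laurentTwist χ k)) n).hom.toAddMonoidHom

/-- The map `Hⁿ(G, M(k - 1)) → Hⁿ⁺¹(G((t)), M(k))`, `x ↦ x ∪ (t)`. -/
noncomputable def cupT [CompactSpace G] (n : ℕ) :
    continuousCohomology n (M.twist χ (k - 1)) →+
      continuousCohomology (1 + n) (M.laurentTwist χ k) :=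
  (((M.twistPairing χ k).res (LaurentExt.proj χ)).cup n 1).flip (LaurentExt.tClass χ) |>.comp
    (M.infl χ (k - 1) n)

variable {M χ} {G' : Type u} [Group G'] [TopologicalSpace G'] [IsTopologicalGroup G']
  {χ' : G' →ₜ* ℤ_[p]ˣ} {M' : FpModule.{u} p G'} (φ : G' →ₜ* G) (hφ : ∀ g, χ (φ g) = χ' g)
  (f : M.V →ₗ[ZMod p] M'.V) (hf : ∀ g m, f (M.ρ (φ g) m) = M'.ρ g (f m))

/-- The map `M(k) → M'(k)` induced by an equivariant map `f : M → M'`. -/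
noncomputable def twistMap : TopRep.res (φ : G' →* G) (M.twist χ k) ⟶ M'.twist χ' k :=
  TopRep.ofHom
    { toFun := f
      map_add' := map_add f
      map_smul' := fun n x => map_zsmul f n x
      cont := continuous_of_discreteTopology (α := M.V)
      isIntertwining' := fun g => by
        ext m
        refine (f.map_smul (modChar χ k (φ g)) (M.ρ (φ g) m)).trans ?_
        rw [modChar, hφ]
        exact congrArg (fun z : M'.V => (modChar χ' k g • z : M'.V)) (hf g m) }

/-- The map `Hⁿ(G, M(k)) → Hⁿ(G', M'(k))` induced by `φ : G' → G` and `f : M → M'`. -/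
noncomputable def cohMap (n : ℕ) :
    continuousCohomology n (M.twist χ k) →+ continuousCohomology n (M'.twist χ' k) :=
  (ContinuousCohomology.map φ (twistMap k φ hφ f hf) n).hom.toAddMonoidHom

/-- The map `Hⁿ(G((t)), M(k)) → Hⁿ(G'((t)), M'(k))` induced by `φ : G' → G` and `f : M → M'`. -/
noncomputable def laurentCohMap (n : ℕ) :
    continuousCohomology n (M.laurentTwist χ k) →+
      continuousCohomology n (M'.laurentTwist χ' k) :=
  (ContinuousCohomology.map (X := M.laurentTwist χ k) (Y := M'.laurentTwist χ' k)
    (LaurentExt.map φ hφ) ((TopRep.resFunctor (LaurentExt.proj χ' : LaurentExt χ' →* G')).map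
      (twistMap k φ hφ f hf)) n).hom.toAddMonoidHom

end FpModule

/-- A `(1, ∞)`-cyclotomic pair `(G, ℤ_p(1))`: a profinite group `G` and a continuous character
`χ : G → ℤ_pˣ`, such that `ℤ_p(1)`, i.e. `ℤ_p` with `G` acting through `χ`, satisfies
the lifting condition. -/
structure CyclotomicPair (p : ℕ) [Fact p.Prime] where
  G : Type u
  [group : Group G]
  [topologicalSpace : TopologicalSpace G]
  [isTopologicalGroup : IsTopologicalGroup G]
  [compactSpace : CompactSpace G]
  [totallyDisconnectedSpace : TotallyDisconnectedSpace G]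
  χ : G →ₜ* ℤ_[p]ˣ
  isCyclotomic : IsCyclotomic 1 χ

attribute [instance] CyclotomicPair.group CyclotomicPair.topologicalSpace
  CyclotomicPair.isTopologicalGroup CyclotomicPair.compactSpace
  CyclotomicPair.totallyDisconnectedSpace

end Laurent

/-! Every class of G((t)) in degree n + 1 is uniquely of the form inf(x) + inf(y) ∪ (t): `infl` and
`cupT` together give an isomorphism H^(n+1)(G, M(k)) × H^n(G, M(k-1)) ≃ H^(n+1)(G((t)), M(k))
(`laurentEquiv`). The residue is the second coordinate of its inverse. Exactness and splitting are
then immediate, and naturality follows from that of inflation and of the product with (t).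

The isomorphism is proved by dimension shifting along 0 → M → I → I/M → 0, with I the locally
constant functions G → M. Since I need not be finite-dimensional, the induction runs over all
discrete 𝔽_p-representations (`DiscreteFpModule`). It is carried out on homogeneous cochains, on
which these coefficient sequences remain exact.

The input is that H^m(G, I(k)) = 0 for m ≥ 1 and H^m(G((t)), I(k)) = 0 for m ≥ 2. Conceptually this
is Shapiro's lemma together with cd_p(ℤ_p) = 1. Concretely, a cocycle z has the non-invariant
primitive z(1). For G((t)), this primitive is made ℤ_p(1)-invariant by solving σy - y = w for the
topological generator σ of ℤ_p(1), which amounts to summing functions on ℤ_p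
(`PadicInt.exists_add_one_sub_eq`). Its G-translates are then merged into one invariant primitive by
evaluation on the diagonal (`Assembly`).

In degree one, a cocycle restricts to ℤ_p(1) as x ↦ x b₀ with b₀ a G-invariant of M(k-1);
subtracting b₀ ∪ t leaves an inflated cocycle (`exists_inflC_add_cupC_one`). Shifting gives
existence of the decomposition in all degrees (`exists_inflC_add_cupC`). For uniqueness, restriction
along the section G → G((t)) retracts inflation and kills products with t, so only the injectivity
of y ↦ inf(y) ∪ (t) remains. It follows by a second shift that uses the decomposition for I
(`exists_dC_eq_of_cupC_eq`). -/

instance ContinuousMap.discreteTopology_of_compactSpace {X Y : Type*} [TopologicalSpace X]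
    [CompactSpace X] [TopologicalSpace Y] [DiscreteTopology Y] : DiscreteTopology C(X, Y) := by
  refine discreteTopology_iff_isOpen_singleton.2 fun f => ?_
  have hfin : (Set.range f).Finite := (isCompact_range f.continuous).finite_of_discrete
  -- The map f has finitely many values and compact fibres, so {f} is a finite intersection of basic
  -- open sets of the compact-open topology.
  have heq : ({f} : Set C(X, Y)) =
      ⋂ y ∈ Set.range f, {g : C(X, Y) | Set.MapsTo g (f ⁻¹' {y}) {y}} := by
    ext g
    simp only [Set.mem_singleton_iff, Set.mem_iInter, Set.mem_ofPred_eq]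
    constructor
    · rintro rfl y _ x hx
      exact hx
    · intro h
      ext x
      exact h (f x) ⟨x, rfl⟩ rfl
  rw [heq]
  exact hfin.isOpen_biInter fun y _ => ContinuousMap.isOpen_setOfPred_mapsTo
    ((isClosed_discrete {y}).preimage f.continuous).isCompact (isOpen_discrete _)

/-! ### Smooth modules, homogeneous cochains and their functoriality -/

namespace TopRep

variable {G : Type u} [Group G] [TopologicalSpace G]

/-- A topological representation is smooth if it is discrete and the action is continuous. -/
class Smooth (A : TopRep.{u} ℤ G) : Prop where
  discreteTopology : DiscreteTopology A.V
  continuous_action : Continuous fun x : G × A.V => A.ρ x.1 x.2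

attribute [instance] Smooth.discreteTopology

instance Smooth.res {H : Type u} [Group H] [TopologicalSpace H] (φ : H →ₜ* G)
    (A : TopRep.{u} ℤ G) [Smooth A] : Smooth (TopRep.res (φ : H →* G) A) where
  discreteTopology := Smooth.discreteTopology (A := A)
  continuous_action := (Smooth.continuous_action (A := A)).comp
    ((φ.continuous_toFun.comp continuous_fst).prodMk continuous_snd)

lemma Smooth.continuous_orbit (A : TopRep.{u} ℤ G) [Smooth A] (a : A.V) :
    Continuous fun g : G => A.ρ g a :=
  Smooth.continuous_action.comp (continuous_id.prodMk continuous_const)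

variable [IsTopologicalGroup G]

instance Smooth.coind₁ [CompactSpace G] (A : TopRep.{u} ℤ G) [Smooth A] :
    Smooth (TopRep.coind₁ A) where
  discreteTopology := inferInstanceAs (DiscreteTopology C(G, A.V))
  continuous_action := by
    refine ContinuousMap.continuous_of_continuous_uncurry _ ?_
    have h : Continuous fun x : (G × C(G, A.V)) × G => A.ρ x.1.1 (x.1.2 (x.1.1⁻¹ * x.2)) :=
      Smooth.continuous_action.comp ((continuous_fst.comp continuous_fst).prodMk
        (continuous_eval.comp ((continuous_snd.comp continuous_fst).prodMk
          (((continuous_fst.comp continuous_fst).inv).mul continuous_snd))))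
    exact h

instance Smooth.resolutionX [CompactSpace G] (A : TopRep.{u} ℤ G) [hA : Smooth A] (n : ℕ) :
    Smooth (TopRep.resolutionX A n : TopRep.{u} ℤ G) := by
  induction n with
  | zero => exact hA
  | succ n ih => exact Smooth.coind₁ _

lemma dX_dX (A : TopRep.{u} ℤ G) (n : ℕ) (x : (resolutionX A n).V) :
    dX A (n + 1) (dX A n x) = 0 :=
  congr($(d_comp_d A n).hom x)

/-- Evaluation at 1 is a contracting homotopy of the standard resolution. It is not equivariant, and
making such primitives invariant is the whole task in the vanishing results below. -/
lemma dX_apply_one (A : TopRep.{u} ℤ G) (n : ℕ) (x : (resolutionX A (n + 1)).V)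
    (h : dX A (n + 1) x = 0) : dX A n ((show C(G, (resolutionX A n).V) from x) 1) = x := by
  have h1 := dX_succ A n x 1
  rw [h] at h1
  exact (sub_eq_zero.1 h1.symm).symm

lemma dX_ρ (A : TopRep.{u} ℤ G) (n : ℕ) (g : G) (x : (resolutionX A n).V) :
    dX A n ((resolutionX A n).ρ g x) = (resolutionX A (n + 1)).ρ g (dX A n x) :=
  hom_comm_apply (d A n) g x

/-- The invariant function `g ↦ g • x`. -/
def orbitCochain [CompactSpace G] (A : TopRep.{u} ℤ G) [Smooth A] (n : ℕ)
    (x : (resolutionX A n).V) : (homogeneousCochains A).X n :=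
  ⟨(⟨fun g => (resolutionX A n).ρ g x, Smooth.continuous_orbit _ x⟩ : C(G, (resolutionX A n).V)),
    fun g => ContinuousMap.ext fun h => by
      change (resolutionX A n).ρ g ((resolutionX A n).ρ (g⁻¹ * h) x) = (resolutionX A n).ρ h x
      have := congr($(map_mul (resolutionX A n).ρ g (g⁻¹ * h)) x)
      rw [mul_inv_cancel_left] at this
      exact this.symm⟩

/-- An invariant cochain is determined by its value at 1. -/
lemma cochain_apply {A : TopRep.{u} ℤ G} {n : ℕ} (F : (homogeneousCochains A).X n) (g : G) :
    (show C(G, (resolutionX A n).V) from F.1) g =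
      (resolutionX A n).ρ g ((show C(G, (resolutionX A n).V) from F.1) 1) := by
  have h : (show C(G, (resolutionX A n).V) from (resolutionX A (n + 1)).ρ g F.1) g =
      (show C(G, (resolutionX A n).V) from F.1) g := congrArg (fun f : C(G, (resolutionX A n).V) => f g) (F.2 g)
  rw [← h]
  change (resolutionX A n).ρ g ((show C(G, (resolutionX A n).V) from F.1) (g⁻¹ * g)) = _
  rw [inv_mul_cancel]

/-- The differentials on homogeneous cochains. -/
def dC (A : TopRep.{u} ℤ G) (i j : ℕ) :
    (homogeneousCochains A).X i →+ (homogeneousCochains A).X j :=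
  ((homogeneousCochains A).d i j).hom.toLinearMap.toAddMonoidHom

lemma dC_coe (A : TopRep.{u} ℤ G) (n : ℕ) (F : (homogeneousCochains A).X n) :
    (dC A n (n + 1) F).1 = dX A (n + 1) F.1 :=
  homogeneousCochains.d_apply A n F

lemma dC_of_ne (A : TopRep.{u} ℤ G) {i j : ℕ} (h : i + 1 ≠ j) (F : (homogeneousCochains A).X i) :
    dC A i j F = 0 :=
  congr($((homogeneousCochains A).shape i j h).hom F)

lemma dC_dC (A : TopRep.{u} ℤ G) (i j k : ℕ) (F : (homogeneousCochains A).X i) :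
    dC A j k (dC A i j F) = 0 :=
  congr($((homogeneousCochains A).d_comp_d i j k).hom F)

section Map

variable {H : Type u} [Group H] [TopologicalSpace H] [IsTopologicalGroup H]
  {A : TopRep.{u} ℤ G} {B : TopRep.{u} ℤ H} (φ : H →ₜ* G) (f : TopRep.res (φ : H →* G) A ⟶ B)

/-- The map on the terms of the standard resolutions, as a function. -/
def mapX (n : ℕ) (x : (resolutionX A n).V) : (resolutionX B n).V :=
  (ContinuousCohomology.resolutionMap φ f n).hom x

lemma mapX_ρ (n : ℕ) (h : H) (x : (resolutionX A n).V) :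
    mapX φ f n ((resolutionX A n).ρ (φ h) x) = (resolutionX B n).ρ h (mapX φ f n x) :=
  hom_comm_apply (ContinuousCohomology.resolutionMap φ f n) h x

/-- The map on homogeneous cochains. -/
def mapC (n : ℕ) : (homogeneousCochains A).X n →+ (homogeneousCochains B).X n :=
  ((ContinuousCohomology.cochainsMap φ f).f n).hom.toLinearMap.toAddMonoidHom

lemma dC_mapC (i j : ℕ) (F : (homogeneousCochains A).X i) :
    dC B i j (mapC φ f i F) = mapC φ f j (dC A i j F) :=
  congr($((ContinuousCohomology.cochainsMap φ f).comm i j).hom F)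

/-- The map on homogeneous cocycles. -/
def mapCocycle (n : ℕ) (F : Cocycle A n) : Cocycle B n :=
  ⟨mapC φ f n F.1, by
    have h := dC_mapC φ f n (n + 1) F.1
    have h2 : dC A n (n + 1) F.1 = 0 := F.2
    rw [h2, map_zero] at h
    exact h⟩

/-- Bridge from the abstract functoriality of cohomology to explicit cocycles, so that later
identities can be checked on cochains. -/
lemma map_cocycleClass (n : ℕ) (F : Cocycle A n) :
    (ContinuousCohomology.map φ f n).hom (cocycleClass A n F) =
      cocycleClass B n (mapCocycle φ f n F) := by
  obtain ⟨y, hy⟩ : ∃ y : (homogeneousCochains A).cycles n,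
      ((homogeneousCochains A).iCycles n).hom y = F.1 := ⟨_,
    congr($((homogeneousCochains A).liftCycles_i
      (TopModuleCat.kerι ((homogeneousCochains A).d n (n + 1))) (n + 1) (by simp)
      (TopModuleCat.kerι_comp _)).hom F)⟩
  rw [TopModuleCat.cls_eq _ n F y hy]
  refine Eq.trans congr($(ContinuousCohomology.π_map φ f n).hom y) ?_
  refine (TopModuleCat.cls_eq _ n _ ((ContinuousCohomology.cocyclesMap φ f n).hom y) ?_).symm
  refine Eq.trans congr($(HomologicalComplex.cyclesMap_i
    (ContinuousCohomology.cochainsMap φ f) n).hom y) ?_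
  exact congrArg ((ContinuousCohomology.cochainsMap φ f).f n).hom hy

end Map

lemma cocycleClass_eq_iff {A : TopRep.{u} ℤ G} {n : ℕ} (F E : Cocycle A n) :
    cocycleClass A n F = cocycleClass A n E ↔ ∃ i W, dC A i n W = F.1 - E.1 := by
  rw [← sub_eq_zero, ← map_sub]
  exact TopModuleCat.cls_eq_zero_iff _ n (F - E)

/-! ### Exactness of cochains in the coefficients -/

section Exact

variable {A B C : TopRep.{u} ℤ G} (f : A ⟶ B) (g : B ⟶ C)

/-- The map on homogeneous cochains induced by a map of coefficients. -/
def coeffC (n : ℕ) : (homogeneousCochains A).X n →+ (homogeneousCochains B).X n :=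
  mapC (A := A) (ContinuousMonoidHom.id G) f n

/-- The map on the terms of the standard resolutions induced by a map of coefficients. -/
abbrev coeffX (n : ℕ) (x : (resolutionX A n).V) : (resolutionX B n).V :=
  mapX (A := A) (ContinuousMonoidHom.id G) f n x

lemma dC_coeffC (i j : ℕ) (F : (homogeneousCochains A).X i) :
    dC B i j (coeffC f i F) = coeffC f j (dC A i j F) :=
  dC_mapC (A := A) (ContinuousMonoidHom.id G) f i j F

lemma coeffX_injective (hf : Function.Injective f.hom) (n : ℕ) :
    Function.Injective (coeffX f n) := by
  induction n with
  | zero => exact hf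
  | succ n ih =>
    intro x y hxy
    refine ContinuousMap.ext fun γ => ih ?_
    exact congrArg (fun f : C(G, (resolutionX B n).V) => f γ) hxy

lemma coeffC_injective (hf : Function.Injective f.hom) (n : ℕ) :
    Function.Injective (coeffC f n) := fun _ _ h =>
  Subtype.ext (coeffX_injective f hf (n + 1) (congrArg Subtype.val h))

lemma coeffC_coeffC_eq_zero (hfg : ∀ a, g.hom (f.hom a) = 0) (n : ℕ)
    (F : (homogeneousCochains A).X n) : coeffC g n (coeffC f n F) = 0 := by
  have h (n : ℕ) (x : (resolutionX A n).V) : coeffX g n (coeffX f n x) = 0 := by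
    induction n with
    | zero => exact hfg x
    | succ n ih =>
      exact ContinuousMap.ext fun γ => ih ((show C(G, (resolutionX A n).V) from x) γ)
  exact Subtype.ext (h (n + 1) F.1)

variable [CompactSpace G]

/-- Any set-theoretic section between the values is continuous, because the terms of the resolution
of B are discrete; this is where smoothness enters. -/
lemma coeffX_surjective [Smooth B] (hf : Function.Surjective f.hom) (n : ℕ) :
    Function.Surjective (coeffX f n) := by
  induction n with
  | zero => exact hf
  | succ n ih =>
    intro y
    refine ⟨(⟨fun γ => Function.surjInv ih ((show C(G, (resolutionX B n).V) from y) γ),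
      (continuous_of_discreteTopology (f := Function.surjInv ih)).comp
        (show C(G, (resolutionX B n).V) from y).continuous⟩ : C(G, (resolutionX A n).V)),
      ContinuousMap.ext fun γ => Function.surjInv_eq ih _⟩

lemma coeffX_exact [Smooth B] (hfg : ∀ b, g.hom b = 0 → ∃ a, f.hom a = b) (n : ℕ)
    (x : (resolutionX B n).V) (hx : coeffX g n x = 0) : ∃ y, coeffX f n y = x := by
  induction n with
  | zero => exact hfg x hx
  | succ n ih =>
    classical
    let x' : C(G, (resolutionX B n).V) := x
    have hx' (γ : G) : coeffX g n (x' γ) = 0 :=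
      congrArg (fun f : C(G, (resolutionX C n).V) => f γ) hx
    -- A preimage chosen value by value; the default 0 is never reached, since all values of x are
    -- killed by g.
    let s (z : (resolutionX B n).V) : (resolutionX A n).V :=
      if h : coeffX g n z = 0 then (ih z h).choose else 0
    refine ⟨(⟨fun γ => s (x' γ), (continuous_of_discreteTopology (f := s)).comp
      x'.continuous⟩ : C(G, (resolutionX A n).V)), ContinuousMap.ext fun γ => ?_⟩
    change coeffX f n (s (x' γ)) = x' γ
    simp only [s, dif_pos (hx' γ)]
    exact (ih _ (hx' γ)).choose_spec

/-- A lift of F need not be invariant, so only the value F(1) is lifted and then spread out along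
its orbit. -/
lemma coeffC_surjective [Smooth A] [Smooth B] (hf : Function.Surjective f.hom) (n : ℕ) :
    Function.Surjective (coeffC f n) := by
  intro F
  obtain ⟨x, hx⟩ := coeffX_surjective f hf n ((show C(G, (resolutionX B n).V) from F.1) 1)
  refine ⟨orbitCochain A n x, Subtype.ext (ContinuousMap.ext fun γ => ?_)⟩
  refine Eq.trans ?_ (cochain_apply F γ).symm
  rw [← hx]
  exact mapX_ρ (A := A) (ContinuousMonoidHom.id G) f n γ x

/-- The preimage supplied by `coeffX_exact` is automatically invariant, because f is injective. -/
lemma coeffC_exact [Smooth B] (hf : Function.Injective f.hom)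
    (hfg : ∀ b, g.hom b = 0 → ∃ a, f.hom a = b) (n : ℕ)
    (F : (homogeneousCochains B).X n) (hF : coeffC g n F = 0) : ∃ E, coeffC f n E = F := by
  obtain ⟨y, hy⟩ := coeffX_exact f g hfg (n + 1) F.1 (congrArg Subtype.val hF)
  refine ⟨⟨y, fun γ => coeffX_injective f hf (n + 1) ?_⟩, Subtype.ext hy⟩
  refine (mapX_ρ (A := A) (ContinuousMonoidHom.id G) f (n + 1) γ y).trans ?_
  exact (congrArg _ hy).trans ((F.2 γ).trans hy.symm)

end Exact

end TopRep

/-! ### The difference operator on functions on ℤ_p -/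

section Difference

variable {p : ℕ} [Fact p.Prime]

lemma PadicInt.dist_le_of_toZModPow_eq {k : ℕ} {x y : ℤ_[p]}
    (h : PadicInt.toZModPow k x = PadicInt.toZModPow k y) : dist x y ≤ (p : ℝ) ^ (-k : ℤ) := by
  rw [dist_eq_norm, PadicInt.norm_le_pow_iff_mem_span_pow, ← PadicInt.ker_toZModPow,
    RingHom.mem_ker, map_sub, h, sub_self]

lemma PadicInt.toZModPow_eq_of_dist_le {k : ℕ} {x y : ℤ_[p]}
    (h : dist x y ≤ (p : ℝ) ^ (-k : ℤ)) : PadicInt.toZModPow k x = PadicInt.toZModPow k y := by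
  rwa [dist_eq_norm, PadicInt.norm_le_pow_iff_mem_span_pow, ← PadicInt.ker_toZModPow,
    RingHom.mem_ker, map_sub, sub_eq_zero] at h

/-- A continuous function from `ℤ_p` to a discrete space factors through some `ℤ/p^k`. -/
lemma PadicInt.exists_forall_toZModPow_eq {Y : Type*} [TopologicalSpace Y] [DiscreteTopology Y]
    (f : C(ℤ_[p], Y)) :
    ∃ k : ℕ, ∀ x y, PadicInt.toZModPow k x = PadicInt.toZModPow k y → f x = f y := by
  -- A Lebesgue number for the cover by fibres bounds the scale below which f is constant.
  obtain ⟨δ, hδ, h⟩ := lebesgue_number_lemma_of_metric (s := Set.univ) (c := fun y => f ⁻¹' {y})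
    isCompact_univ (fun y => (isOpen_discrete _).preimage f.continuous)
    (fun x _ => Set.mem_iUnion.2 ⟨f x, rfl⟩)
  obtain ⟨k, hk⟩ := PadicInt.exists_pow_neg_lt p hδ
  refine ⟨k, fun x y hxy => ?_⟩
  obtain ⟨z, hz⟩ := h y (Set.mem_univ _)
  have h1 : f x = z := hz (Metric.mem_ball.2 ((PadicInt.dist_le_of_toZModPow_eq hxy).trans_lt hk))
  have h2 : f y = z := hz (Metric.mem_ball_self hδ)
  rw [h1, h2]

lemma PadicInt.continuous_toZModPow_comp {Y : Type*} [TopologicalSpace Y] (k : ℕ)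
    (F : ZMod (p ^ k) → Y) : Continuous fun x : ℤ_[p] => F (PadicInt.toZModPow k x) := by
  have hp : (0 : ℝ) < (p : ℝ) ^ (-k : ℤ) :=
    zpow_pos (by exact_mod_cast (Fact.out : p.Prime).pos) _
  refine IsLocallyConstant.continuous ((IsLocallyConstant.iff_eventually_eq _).2 fun x => ?_)
  filter_upwards [Metric.ball_mem_nhds x hp] with y hy
  rw [PadicInt.toZModPow_eq_of_dist_le (Metric.mem_ball.1 hy).le]

/-- The difference operator is surjective on the continuous functions from `ℤ_p` to a discrete
abelian group of exponent `p`. -/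
lemma PadicInt.exists_add_one_sub_eq {Y : Type*} [AddCommGroup Y] [TopologicalSpace Y]
    [DiscreteTopology Y] (hY : ∀ y : Y, p • y = 0) (f : C(ℤ_[p], Y)) :
    ∃ F : C(ℤ_[p], Y), ∀ x, F (x + 1) - F x = f x := by
  obtain ⟨k, hk⟩ := PadicInt.exists_forall_toZModPow_eq f
  -- Partial sums solve the equation on ℕ; it remains to see that they extend continuously to ℤ_p.
  let S (n : ℕ) : Y := ∑ i ∈ Finset.range n, f i
  have hper (i : ℕ) : f ((i + p ^ k : ℕ) : ℤ_[p]) = f i := by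
    refine hk _ _ ?_
    rw [map_natCast, map_natCast, Nat.cast_add, ZMod.natCast_self, add_zero]
  have hmul (n m : ℕ) : S (n + m * p ^ k) = S n + m • (S (n + p ^ k) - S n) := by
    have hstep (n : ℕ) : S (n + p ^ k) - S n = S (p ^ k) := by
      induction n with
      | zero => simp [S]
      | succ n ih =>
        rw [← ih, add_right_comm]
        change (∑ i ∈ Finset.range (n + p ^ k + 1), f i) - ∑ i ∈ Finset.range (n + 1), f i = _
        rw [Finset.sum_range_succ, Finset.sum_range_succ, hper]
        simp only [S]
        abel
    rw [hstep]
    induction m with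
    | zero => simp
    | succ m ih =>
      have h := hstep (n + m * p ^ k)
      rw [sub_eq_iff_eq_add] at h
      rw [add_mul, one_mul, ← add_assoc, h, ih, succ_nsmul]
      abel
  -- The sum over one full period of length p^k does not depend on its start, and p such sums
  -- cancel. Hence the level rises from k to k + 1.
  have hS : Function.Periodic S (p ^ (k + 1)) := fun n => by
    have h := hmul n p
    rwa [hY, add_zero, ← pow_succ'] at h
  have : NeZero (p ^ (k + 1)) := ⟨pow_ne_zero _ (Fact.out : p.Prime).ne_zero⟩
  refine ⟨⟨fun x => S (PadicInt.toZModPow (k + 1) x).val,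
    PadicInt.continuous_toZModPow_comp (k + 1) fun z => S z.val⟩, fun x => ?_⟩
  change S (PadicInt.toZModPow (k + 1) (x + 1)).val - S (PadicInt.toZModPow (k + 1) x).val = f x
  have hval (x : ℤ_[p]) (n : ℕ) (h : PadicInt.toZModPow (k + 1) x = n) :
      S (PadicInt.toZModPow (k + 1) x).val = S n := by
    rw [h, ZMod.val_natCast, hS.map_mod_nat]
  have hx : PadicInt.toZModPow (k + 1) x =
      ((PadicInt.toZModPow (k + 1) x).val : ZMod (p ^ (k + 1))) := (ZMod.natCast_zmod_val _).symm
  rw [hval (x + 1) ((PadicInt.toZModPow (k + 1) x).val + 1)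
    (by rw [map_add, map_one, Nat.cast_add, ← hx, Nat.cast_one])]
  refine (sub_eq_iff_eq_add'.2 (Finset.sum_range_succ _ _)).trans (hk _ _ ?_)
  have h := congrArg (ZMod.castHom (pow_dvd_pow p (Nat.le_succ k)) (ZMod (p ^ k))) hx
  have h2 (y : ℤ_[p]) : ZMod.castHom (pow_dvd_pow p (Nat.le_succ k)) (ZMod (p ^ k))
      (PadicInt.toZModPow (k + 1) y) = PadicInt.toZModPow k y :=
    PadicInt.cast_toZModPow k (k + 1) (Nat.le_succ k) y
  rw [h2, map_natCast] at h
  rw [map_natCast, h]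

end Difference

/-! ### Merging translates: invariant primitives in coinduced modules -/

namespace TopRep

variable {G Γ : Type u} [Group G] [TopologicalSpace G] [Group Γ] [TopologicalSpace Γ]

/-- For `π : Γ → G`, an operation `C(G, A) → A` on a `Γ`-module `A`, compatible with the action of
`Γ`. If `A = C(G, X)`, evaluation on the diagonal is such an operation. -/
structure Assembly (π : Γ →ₜ* G) (A : TopRep.{u} ℤ Γ) where
  toFun : C(G, A.V) → A.V
  map_sub : ∀ φ ψ, toFun (φ - ψ) = toFun φ - toFun ψ
  map_const : ∀ a, toFun (ContinuousMap.const G a) = a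
  equivariant : ∀ γ φ ψ, (∀ g, ψ g = A.ρ γ (φ ((π γ)⁻¹ * g))) → A.ρ γ (toFun φ) = toFun ψ

namespace Assembly

variable [CompactSpace G] [IsTopologicalGroup Γ] [CompactSpace Γ]
  {π : Γ →ₜ* G} {A : TopRep.{u} ℤ Γ} [Smooth A] (asm : Assembly π A)

/-- The extension of an assembly operation to the standard resolution. -/
def asmX : (j : ℕ) → C(G, (resolutionX A j).V) → (resolutionX A j).V
  | 0 => asm.toFun
  | j + 1 => fun φ =>
    -- The operation acts pointwise in Γ; `asmX j` is continuous because C(G, ·) is discrete for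
    -- compact G.
    (ContinuousMap.mk (asmX j) continuous_of_discreteTopology).comp
      (ContinuousMap.curry (X := Γ) (Y := G) (Z := (resolutionX A j).V)
        ⟨fun x => (show C(Γ, (resolutionX A j).V) from φ x.2) x.1, by
          have h : Continuous fun x : Γ × G => (show C(Γ, (resolutionX A j).V) from φ x.2) :=
            φ.continuous.comp continuous_snd
          exact continuous_eval.comp (h.prodMk continuous_fst)⟩)

/-- Evaluation of a family of elements of `C(Γ, R)` at an element of `Γ`. -/
def evalAt {j : ℕ} (φ : C(G, (resolutionX A (j + 1)).V)) (γ : Γ) : C(G, (resolutionX A j).V) :=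
  ⟨fun g => (show C(Γ, (resolutionX A j).V) from φ g) γ, by
    have h : Continuous fun g : G => (show C(Γ, (resolutionX A j).V) from φ g) := φ.continuous
    exact (continuous_eval_const γ).comp h⟩

lemma asmX_apply (j : ℕ) (φ : C(G, (resolutionX A (j + 1)).V)) (γ : Γ) :
    (show C(Γ, (resolutionX A j).V) from asm.asmX (j + 1) φ) γ = asm.asmX j (evalAt φ γ) := rfl

lemma asmX_sub (j : ℕ) (φ ψ : C(G, (resolutionX A j).V)) :
    asm.asmX j (φ - ψ) = asm.asmX j φ - asm.asmX j ψ := by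
  induction j with
  | zero => exact asm.map_sub φ ψ
  | succ j ih => exact ContinuousMap.ext fun γ => ih (evalAt φ γ) (evalAt ψ γ)

lemma asmX_const (j : ℕ) (a : (resolutionX A j).V) :
    asm.asmX j (ContinuousMap.const G a) = a := by
  induction j with
  | zero => exact asm.map_const a
  | succ j ih => exact ContinuousMap.ext fun γ => ih ((show C(Γ, (resolutionX A j).V) from a) γ)

lemma asmX_equivariant (j : ℕ) (γ : Γ) (φ ψ : C(G, (resolutionX A j).V))
    (h : ∀ g, ψ g = (resolutionX A j).ρ γ (φ ((π γ)⁻¹ * g))) :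
    (resolutionX A j).ρ γ (asm.asmX j φ) = asm.asmX j ψ := by
  induction j with
  | zero => exact asm.equivariant γ φ ψ h
  | succ j ih =>
    refine ContinuousMap.ext fun δ => ?_
    refine ih (evalAt φ (γ⁻¹ * δ)) (evalAt ψ δ) fun g => ?_
    exact congrArg (fun f : C(Γ, (resolutionX A j).V) => f δ) (h g)

/-- Each differential is a constant family minus a lower differential, and the assembly operation
respects differences and fixes constants. -/
lemma dX_asmX (j : ℕ) (φ : C(G, (resolutionX A j).V)) (ψ : C(G, (resolutionX A (j + 1)).V))
    (h : ∀ g, ψ g = dX A j (φ g)) : dX A j (asm.asmX j φ) = asm.asmX (j + 1) ψ := by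
  induction j with
  | zero =>
    refine ContinuousMap.ext fun γ => ?_
    refine congrArg asm.toFun (ContinuousMap.ext fun g => ?_)
    exact (congrArg (fun f : C(Γ, A.V) => f γ) (h g)).symm
  | succ j ih =>
    refine ContinuousMap.ext fun γ => ?_
    rw [dX_succ, asmX_apply, asmX_apply]
    have h1 (g : G) : (evalAt ψ γ) g = φ g - dX A j ((evalAt φ γ) g) :=
      (congrArg (fun f : C(Γ, (resolutionX A (j + 1)).V) => f γ) (h g)).trans (dX_succ A j _ γ)
    rw [ih (evalAt φ γ) (φ - evalAt ψ γ) fun g => by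
      rw [ContinuousMap.sub_apply, h1, sub_sub_cancel], asmX_sub, sub_sub_cancel]

/-- An element of the standard resolution with invariant differential, which is invariant under the
kernel of `π`, can be replaced by an invariant one. -/
lemma exists_invariant (asm : Assembly π A) (s : C(G, Γ)) (hs : ∀ g, π (s g) = g) (j : ℕ) (r : (resolutionX A j).V)
    (hr : ∀ γ, π γ = 1 → (resolutionX A j).ρ γ r = r)
    (hd : ∀ γ, (resolutionX A (j + 1)).ρ γ (dX A j r) = dX A j r) :
    ∃ r', (∀ γ, (resolutionX A j).ρ γ r' = r') ∧ dX A j r' = dX A j r := by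
  -- The family of translates s(g)r, which does not depend on the section s because ker π fixes r.
  let φ : C(G, (resolutionX A j).V) :=
    ⟨fun g => (resolutionX A j).ρ (s g) r, (Smooth.continuous_orbit _ r).comp s.continuous⟩
  refine ⟨asm.asmX j φ, fun γ => asm.asmX_equivariant j γ φ φ fun g => ?_, ?_⟩
  · change (resolutionX A j).ρ (s g) r =
      (resolutionX A j).ρ γ ((resolutionX A j).ρ (s ((π γ)⁻¹ * g)) r)
    -- Both s(g) and γ s(π(γ)⁻¹g) lie over g, so they differ by right multiplication by an element
    -- of ker π, which fixes r.
    have h1 : s g * ((s g)⁻¹ * (γ * s ((π γ)⁻¹ * g))) = γ * s ((π γ)⁻¹ * g) :=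
      mul_inv_cancel_left _ _
    have h2 := congr($(map_mul (resolutionX A j).ρ (s g) ((s g)⁻¹ * (γ * s ((π γ)⁻¹ * g)))) r)
    have h3 := congr($(map_mul (resolutionX A j).ρ γ (s ((π γ)⁻¹ * g))) r)
    rw [h1] at h2
    refine Eq.trans ?_ (h2.symm.trans h3)
    refine congrArg ((resolutionX A j).ρ (s g)) (hr _ ?_).symm
    rw [map_mul, map_mul, map_inv, hs, hs, mul_inv_cancel_left, inv_mul_cancel]
  -- Every translate has differential s(g) dr = dr, so the family of differentials is constant.
  · rw [asm.dX_asmX j φ (ContinuousMap.const G (dX A j r)) fun g => ?_, asmX_const]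
    exact ((dX_ρ A j (s g) r).trans (hd _)).symm

/-- Because z is invariant, `exists_invariant` trades the primitive r for an invariant one, that is,
for a genuine cochain. -/
lemma exists_dC_eq (asm : Assembly π A) (s : C(G, Γ)) (hs : ∀ g, π (s g) = g) (j : ℕ)
    (z : (homogeneousCochains A).X (j + 1)) (r : (resolutionX A (j + 1)).V)
    (hr : ∀ γ, π γ = 1 → (resolutionX A (j + 1)).ρ γ r = r) (hz : dX A (j + 1) r = z.1) :
    ∃ W, dC A j (j + 1) W = z := by
  obtain ⟨r', h1, h2⟩ := asm.exists_invariant s hs (j + 1) r hr fun γ => by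
    rw [hz]; exact z.2 γ
  exact ⟨⟨r', h1⟩, Subtype.ext ((dC_coe A j _).trans (h2.trans hz))⟩

end Assembly

/-- Vanishing of the cohomology of coinduced modules. -/
lemma exists_dC_eq_of_assembly [IsTopologicalGroup G] [CompactSpace G] {A : TopRep.{u} ℤ G}
    [Smooth A] (asm : Assembly (ContinuousMonoidHom.id G) A) (j : ℕ)
    (z : (homogeneousCochains A).X (j + 1)) (hz : dC A (j + 1) (j + 2) z = 0) :
    ∃ W, dC A j (j + 1) W = z := by
  refine asm.exists_dC_eq (ContinuousMap.id G) (fun _ => rfl) j z _ (fun γ hγ => ?_)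
    (dX_apply_one A (j + 1) z.1 ((dC_coe A (j + 1) z).symm.trans (congrArg Subtype.val hz)))
  obtain rfl : γ = 1 := hγ
  exact congr($(map_one (resolutionX A (j + 1)).ρ) _)

end TopRep

/-! ### Vanishing for G((t)) in degrees at least two -/

namespace LaurentExt

variable {p : ℕ} [Fact p.Prime] {G : Type u} [Group G] [TopologicalSpace G] (χ : G →ₜ* ℤ_[p]ˣ)

/-- The element of `G((t))` with components `x` and `g`. -/
noncomputable def pair (x : ℤ_[p]) (g : G) : LaurentExt χ := (equivProd χ).symm (x, g)

variable {χ}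

lemma pair_coord_base (a : LaurentExt χ) : pair χ a.coord a.base = a := rfl

lemma continuous_pair : Continuous fun x : ℤ_[p] × G => pair χ x.1 x.2 := (homeo χ).symm.continuous

lemma pair_mul_pair (x y : ℤ_[p]) (g h : G) :
    pair χ x g * pair χ y h = pair χ (x + χ g * y) (g * h) := rfl

lemma pair_add (x y : ℤ_[p]) : pair χ (x + y) 1 = pair χ x 1 * pair χ y 1 := by
  rw [pair_mul_pair, map_one, Units.val_one, one_mul, one_mul]

lemma pair_zero_one : pair χ 0 1 = 1 := rfl

variable (χ) in
/-- The section `g ↦ (0, g)` of the projection `G((t)) → G`. -/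
noncomputable def sec : G →ₜ* LaurentExt χ where
  toFun g := pair χ 0 g
  map_one' := rfl
  map_mul' g h := by rw [pair_mul_pair, mul_zero, add_zero]
  continuous_toFun := continuous_pair.comp (continuous_const.prodMk continuous_id)

lemma proj_sec (g : G) : proj χ (sec χ g) = g := rfl

lemma pair_mul_sec (x : ℤ_[p]) (g : G) : pair χ x 1 * sec χ g = pair χ x g := by
  refine (pair_mul_pair x 0 1 g).trans ?_
  rw [mul_zero, add_zero, one_mul]

lemma sec_mul_pair (x : ℤ_[p]) (g : G) : sec χ g * pair χ x 1 = pair χ (χ g * x) 1 * sec χ g := by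
  rw [pair_mul_sec]
  refine (pair_mul_pair 0 x g 1).trans ?_
  rw [zero_add, mul_one]

open TopRep

/-- An element fixed by the topological generator of `ℤ_p(1)` is fixed by `ℤ_p(1)`. -/
lemma ρ_eq_of_generator (A : TopRep.{u} ℤ (LaurentExt χ)) [Smooth A] (r : A.V)
    (hr : A.ρ (pair χ 1 1) r = r) (γ : LaurentExt χ) (hγ : proj χ γ = 1) : A.ρ γ r = r := by
  have hnat (n : ℕ) : A.ρ (pair χ n 1) r = r := by
    induction n with
    | zero =>
      rw [Nat.cast_zero, pair_zero_one]
      exact congr($(map_one A.ρ) r)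
    | succ n ih =>
      rw [Nat.cast_succ, pair_add]
      refine congr($(map_mul A.ρ _ _) r).trans ?_
      change A.ρ _ (A.ρ _ r) = r
      rw [hr, ih]
  have hcont : Continuous fun x : ℤ_[p] => A.ρ (pair χ x 1) r :=
    (Smooth.continuous_orbit A r).comp (continuous_pair.comp (continuous_id.prodMk continuous_const))
  -- The condition is closed in x, since the orbit map is continuous, and it holds on the dense
  -- subset ℕ of ℤ_p.
  have h := PadicInt.denseRange_natCast.induction_on (p := fun x : ℤ_[p] => A.ρ (pair χ x 1) r = r)
    γ.coord (isClosed_eq hcont continuous_const) hnat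
  have hγ' : pair χ γ.coord 1 = γ := by
    conv_rhs => rw [← pair_coord_base γ]
    exact congrArg (pair χ γ.coord) (Eq.symm hγ)
  rwa [hγ'] at h

variable [IsTopologicalGroup G]

lemma resolutionX_nsmul_eq_zero (A : TopRep.{u} ℤ (LaurentExt χ)) (hA : ∀ a : A.V, p • a = 0)
    (n : ℕ) (x : (resolutionX A n).V) : p • x = 0 := by
  induction n with
  | zero => exact hA x
  | succ n ih =>
    exact ContinuousMap.ext fun γ => ih ((show C(LaurentExt χ, (resolutionX A n).V) from x) γ)

variable [CompactSpace G]

/-- The generator of `ℤ_p(1)` minus the identity is surjective on coinduced modules of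
exponent `p`. -/
lemma exists_ρ_sub_eq (R : TopRep.{u} ℤ (LaurentExt χ)) [Smooth R] (hR : ∀ a : R.V, p • a = 0)
    (w' : C(LaurentExt χ, R.V)) :
    ∃ y : C(LaurentExt χ, R.V), ∀ γ, R.ρ (pair χ 1 1) (y ((pair χ 1 1)⁻¹ * γ)) - y γ = w' γ := by
  have hact (γ δ : LaurentExt χ) (r : R.V) : R.ρ γ (R.ρ δ r) = R.ρ (γ * δ) r :=
    congr($(map_mul R.ρ γ δ) r).symm
  -- Writing y(γ) = γ · F(x, g) for γ = (x, g) removes the action on the values, and σy - y = w'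
  -- becomes F(x - 1, g) - F(x, g) = γ⁻¹w'(γ). Reindexing to a forward difference produces the sign
  -- and the shift x + 1.
  let f : C(ℤ_[p], C(G, R.V)) := ContinuousMap.curry (X := ℤ_[p]) (Y := G) (Z := R.V)
    ⟨fun x => -R.ρ (pair χ (x.1 + 1) x.2)⁻¹ (w' (pair χ (x.1 + 1) x.2)), by
      have hc : Continuous fun x : ℤ_[p] × G => pair χ (x.1 + 1) x.2 :=
        continuous_pair.comp ((continuous_fst.add continuous_const).prodMk continuous_snd)
      have h : Continuous fun x : ℤ_[p] × G =>
          R.ρ (pair χ (x.1 + 1) x.2)⁻¹ (w' (pair χ (x.1 + 1) x.2)) :=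
        (Smooth.continuous_action (A := R)).comp (hc.inv.prodMk (w'.continuous.comp hc))
      exact h.neg⟩
  obtain ⟨F, hF⟩ := PadicInt.exists_add_one_sub_eq (p := p) (Y := C(G, R.V))
    (fun y => ContinuousMap.ext fun g => hR (y g)) f
  let y : C(LaurentExt χ, R.V) := ⟨fun γ => R.ρ γ (F γ.coord γ.base),
    (Smooth.continuous_action (A := R)).comp (continuous_id.prodMk (continuous_eval.comp
      ((F.continuous.comp continuous_coord).prodMk continuous_base)))⟩
  refine ⟨y, fun γ => ?_⟩
  change R.ρ (pair χ 1 1) (R.ρ ((pair χ 1 1)⁻¹ * γ)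
    (F ((pair χ 1 1)⁻¹ * γ).coord ((pair χ 1 1)⁻¹ * γ).base)) - R.ρ γ (F γ.coord γ.base) = w' γ
  have h1 : (pair χ 1 1)⁻¹ * γ = pair χ (γ.coord - 1) γ.base := by
    rw [inv_mul_eq_iff_eq_mul, pair_mul_pair, map_one, Units.val_one, one_mul, one_mul,
      add_sub_cancel, pair_coord_base]
  rw [hact, mul_inv_cancel_left, h1, ← map_sub]
  change R.ρ γ (F (γ.coord - 1) γ.base - F γ.coord γ.base) = w' γ
  have h2 := congrArg (fun h : C(G, R.V) => h γ.base) (hF (γ.coord - 1))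
  rw [sub_add_cancel] at h2
  have h3 : F (γ.coord - 1) γ.base - F γ.coord γ.base = R.ρ γ⁻¹ (w' γ) := by
    rw [← neg_sub, neg_eq_iff_eq_neg]
    refine h2.trans ?_
    change -R.ρ (pair χ (γ.coord - 1 + 1) γ.base)⁻¹ (w' (pair χ (γ.coord - 1 + 1) γ.base)) = _
    rw [sub_add_cancel, pair_coord_base]
  rw [h3, hact, mul_inv_cancel]
  exact congr($(map_one R.ρ) _)

/-- Vanishing of the cohomology of `G((t))` in degrees at least two, with values in modules of
exponent `p` coinduced from `ℤ_p(1)`. -/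
lemma exists_dC_eq_of_assembly (A : TopRep.{u} ℤ (LaurentExt χ)) [Smooth A]
    (hA : ∀ a : A.V, p • a = 0) (asm : Assembly (proj χ) A) (j : ℕ)
    (z : (homogeneousCochains A).X (j + 2)) (hz : dC A (j + 2) (j + 3) z = 0) :
    ∃ W, dC A (j + 1) (j + 2) W = z := by
  have hz' : dX A (j + 3) z.1 = 0 := (dC_coe A (j + 2) z).symm.trans (congrArg Subtype.val hz)
  obtain ⟨r₀, hr₀⟩ : ∃ r, dX A (j + 2) r = z.1 := ⟨_, dX_apply_one A (j + 2) z.1 hz'⟩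
  let σ := pair χ 1 1
  have h1 : dX A (j + 2) ((resolutionX A (j + 2)).ρ σ r₀ - r₀) = 0 := by
    rw [dX_sub, dX_ρ, hr₀]
    exact sub_eq_zero.2 (z.2 σ)
  obtain ⟨w, hw⟩ : ∃ w, dX A (j + 1) w = (resolutionX A (j + 2)).ρ σ r₀ - r₀ :=
    ⟨_, dX_apply_one A (j + 1) _ h1⟩
  -- At index j + 1 the element w lies in a coinduced module C(G((t)), ·); for a cocycle of degree
  -- one it would only lie in A.
  obtain ⟨y, hy⟩ : ∃ y, (resolutionX A (j + 1)).ρ (pair χ 1 1) y - y = w :=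
    let ⟨y, hy⟩ := @exists_ρ_sub_eq p _ G _ _ χ _ _ (resolutionX A j) (Smooth.resolutionX A j)
      (resolutionX_nsmul_eq_zero A hA j) w
    ⟨y, ContinuousMap.ext hy⟩
  -- Subtracting dy does not change the differential, and r₀ - dy is σ-fixed because d(σy - y) = dw
  -- = σr₀ - r₀.
  refine asm.exists_dC_eq (⟨sec χ, (sec χ).continuous_toFun⟩ : C(G, LaurentExt χ)) proj_sec (j + 1) z
    (r₀ - dX A (j + 1) y) (@ρ_eq_of_generator _ _ _ _ _ _ _ (Smooth.resolutionX A (j + 2)) _ ?_) ?_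
  · rw [map_sub, ← dX_ρ, sub_eq_sub_iff_sub_eq_sub, ← dX_sub, hy, hw]
  · rw [dX_sub, dX_dX, sub_zero, hr₀]

end LaurentExt

/-! ### Naturality of cup products of cochains -/

namespace TopRep.Pairing

variable {G H : Type u} [Group G] [TopologicalSpace G] [IsTopologicalGroup G] [Group H]
  [TopologicalSpace H] [IsTopologicalGroup H] {A B C : TopRep.{u} ℤ G} {A' B' C' : TopRep.{u} ℤ H}
  (P : Pairing A B C) (P' : Pairing A' B' C') (φ : H →ₜ* G) (fA : TopRep.res (φ : H →* G) A ⟶ A')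
  (fB : TopRep.res (φ : H →* G) B ⟶ B') (fC : TopRep.res (φ : H →* G) C ⟶ C')

lemma mapX_mulX (h : ∀ a b, fC.hom (P.toFun a b) = P'.toFun (fA.hom a) (fB.hom b)) (j : ℕ)
    (a : A.V) (x : (resolutionX B j).V) :
    mapX φ fC j (P.mulX j (a, x)) = P'.mulX j (fA.hom a, mapX φ fB j x) := by
  induction j with
  | zero => exact h a x
  | succ j ih =>
    exact ContinuousMap.ext fun γ => ih ((show C(G, (resolutionX B j).V) from x) (φ γ))

lemma mapX_cupX [LocallyCompactSpace G] [LocallyCompactSpace H]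
    (h : ∀ a b, fC.hom (P.toFun a b) = P'.toFun (fA.hom a) (fB.hom b)) {j : ℕ}
    (E : (resolutionX B (j + 1)).V) (n : ℕ) (F : (resolutionX A (n + 1)).V) :
    mapX φ fC (j + n + 1) (P.cupX E n F) =
      P'.cupX (mapX φ fB (j + 1) E) n (mapX φ fA (n + 1) F) := by
  induction n with
  | zero =>
    exact ContinuousMap.ext fun γ => P.mapX_mulX P' φ fA fB fC h j
      ((show C(G, A.V) from F) (φ γ)) ((show C(G, (resolutionX B j).V) from E) (φ γ))
  | succ n ih =>
    exact ContinuousMap.ext fun γ => ih ((show C(G, (resolutionX A (n + 1)).V) from F) (φ γ))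

end TopRep.Pairing

/-! ### Discrete 𝔽_p-representations and coinduced modules -/

section

variable {p : ℕ} [Fact p.Prime] {G : Type u} [Group G] [TopologicalSpace G]

lemma FpModule.continuous_modChar (χ : G →ₜ* ℤ_[p]ˣ) (k : ℤ) :
    Continuous (FpModule.modChar χ k) := by
  have h : FpModule.modChar χ k = fun g => PadicInt.toZMod ((χ g ^ k : ℤ_[p]ˣ) : ℤ_[p]) :=
    funext fun g => FpModule.modChar_eq χ k g
  rw [h]
  exact continuous_toZMod.comp (Units.continuous_val.comp (χ.continuous_toFun.zpow k))

lemma FpModule.modChar_sub_one_mul (χ : G →ₜ* ℤ_[p]ˣ) (k : ℤ) (g : G) :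
    FpModule.modChar χ k g = FpModule.modChar χ (k - 1) g * FpModule.modChar χ 1 g := by
  rw [modChar, modChar, modChar, ← Units.val_mul, ← zpow_add, sub_add_cancel]

variable (p G) in
/-- A discrete `𝔽_p`-linear representation of `G`, not necessarily finite. -/
structure DiscreteFpModule where
  V : Type u
  [addCommGroup : AddCommGroup V]
  [module : Module (ZMod p) V]
  ρ : Representation (ZMod p) G V
  isLocallyConstant_orbit : ∀ v, IsLocallyConstant fun g => ρ g v

namespace DiscreteFpModule

attribute [instance] addCommGroup module

instance (M : DiscreteFpModule p G) : TopologicalSpace M.V := ⊥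

instance (M : DiscreteFpModule p G) : DiscreteTopology M.V := ⟨rfl⟩

variable (M : DiscreteFpModule.{u} p G) (χ : G →ₜ* ℤ_[p]ˣ) (k : ℤ)

/-- The cyclotomic twist `M(i)`. -/
noncomputable def twist (i : ℤ) : TopRep.{u} ℤ G :=
  TopRep.of (X := M.V) (ContRepresentation.ofMonoidHom
    { toFun := fun g =>
        { toFun := fun m => FpModule.modChar χ i g • M.ρ g m
          map_add' := fun x y => by simp
          map_smul' := fun n x => by
            rw [map_zsmul]; exact smul_comm _ _ _
          cont := continuous_of_discreteTopology }
      map_one' := by ext x; simp [FpModule.modChar]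
      map_mul' := fun g h => by ext x; simp [FpModule.modChar, mul_zpow, mul_smul] })

lemma continuous_orbit (m : M.V) : Continuous fun g => M.ρ g m :=
  (M.isLocallyConstant_orbit m).continuous

instance : TopRep.Smooth (M.twist χ k) where
  discreteTopology := inferInstanceAs (DiscreteTopology M.V)
  continuous_action := by
    have h (m : M.V) : Continuous fun g => FpModule.modChar χ k g • M.ρ g m := by
      have h1 : Continuous fun y : ZMod p × M.V => y.1 • y.2 := continuous_of_discreteTopology
      exact h1.comp ((FpModule.continuous_modChar χ k).prodMk (M.continuous_orbit m))
    exact (continuous_prod_of_discrete_right (α := G) (β := M.V)).2 h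

lemma nsmul_eq_zero (m : M.V) : p • m = 0 := by
  rw [← Nat.cast_smul_eq_nsmul (ZMod p), ZMod.natCast_self, zero_smul]

/-- The pairing `M(k - 1) × ℤ_p(1) → M(k)`, `(m, x) ↦ x m`. -/
noncomputable def twistPairing [IsTopologicalGroup G] :
    TopRep.Pairing (M.twist χ (k - 1)) (zpTwist χ 1) (M.twist χ k) where
  toFun := fun (m : M.V) x => (PadicInt.toZMod x.down • m : M.V)
  add_left := fun (m m' : M.V) x => smul_add (PadicInt.toZMod x.down) m m'
  add_right := fun (m : M.V) x y => by
    refine Eq.trans ?_ (add_smul (PadicInt.toZMod x.down) (PadicInt.toZMod y.down) m)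
    exact congrArg (fun z : ZMod p => z • m) (map_add PadicInt.toZMod x.down y.down)
  equivariant g m x := by
    change PadicInt.toZMod (((χ g ^ (1 : ℤ) : ℤ_[p]ˣ) : ℤ_[p]) * x.down) •
      (FpModule.modChar χ (k - 1) g • M.ρ g (show M.V from m)) =
      FpModule.modChar χ k g • M.ρ g (PadicInt.toZMod x.down • (show M.V from m))
    rw [map_mul, ← FpModule.modChar_eq, map_smul, smul_smul, smul_smul,
      FpModule.modChar_sub_one_mul χ k]
    congr 1
    ring
  cont := by
    have h : Continuous fun y : ZMod p × M.V => y.1 • y.2 := continuous_of_discreteTopology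
    exact h.comp (((continuous_toZMod (p := p)).comp
      (continuous_uliftDown.comp continuous_snd)).prodMk continuous_fst)

/-- `M(k)` as a `G((t))`-module, through the projection `G((t)) → G`. -/
noncomputable abbrev laurentTwist : TopRep.{u} ℤ (LaurentExt χ) :=
  TopRep.res (LaurentExt.proj χ : LaurentExt χ →* G) (M.twist χ k)

instance : TopRep.Smooth (M.laurentTwist χ k) :=
  TopRep.Smooth.res (LaurentExt.proj χ) (M.twist χ k)

section Map

variable {M χ} {G' : Type u} [Group G'] [TopologicalSpace G']
  {χ' : G' →ₜ* ℤ_[p]ˣ} {M' : DiscreteFpModule.{u} p G'} (φ : G' →ₜ* G) (hφ : ∀ g, χ (φ g) = χ' g)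
  (f : M.V →ₗ[ZMod p] M'.V) (hf : ∀ g m, f (M.ρ (φ g) m) = M'.ρ g (f m))

/-- The map `M(k) → M'(k)` induced by an equivariant map `f : M → M'`. -/
noncomputable def twistMap : TopRep.res (φ : G' →* G) (M.twist χ k) ⟶ M'.twist χ' k :=
  TopRep.ofHom
    { toFun := f
      map_add' := map_add f
      map_smul' := fun n x => map_zsmul f n x
      cont := continuous_of_discreteTopology (α := M.V)
      isIntertwining' := fun g => by
        ext m
        refine (f.map_smul (FpModule.modChar χ k (φ g)) (M.ρ (φ g) m)).trans ?_
        rw [FpModule.modChar, hφ]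
        exact congrArg (fun z : M'.V => (FpModule.modChar χ' k g • z : M'.V)) (hf g m) }

/-- The map `M(k) → M'(k)` as a map of `G'((t))`-modules. -/
noncomputable def laurentTwistMap :
    TopRep.res (LaurentExt.map φ hφ : LaurentExt χ' →* LaurentExt χ) (M.laurentTwist χ k) ⟶
      M'.laurentTwist χ' k :=
  (TopRep.resFunctor (LaurentExt.proj χ' : LaurentExt χ' →* G')).map (twistMap k φ hφ f hf)

end Map

/-- The coinduced module of locally constant functions `G → M`. -/
noncomputable def coind [IsTopologicalGroup G] [CompactSpace G] : DiscreteFpModule.{u} p G where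
  V := LocallyConstant G M.V
  ρ :=
    { toFun := fun g =>
        { toFun := fun f => (f.comap ⟨fun x => g⁻¹ * x, continuous_const_mul g⁻¹⟩).map (M.ρ g)
          map_add' := fun f f' => by ext x; simp
          map_smul' := fun c f => by ext x; simp }
      map_one' := by ext f x; simp
      map_mul' := fun g h => by ext f x; simp [mul_assoc] }
  isLocallyConstant_orbit f := by
    have h : Continuous fun x : G × G => M.ρ x.1 (f (x.1⁻¹ * x.2)) := by
      have h1 : Continuous fun x : G × M.V => M.ρ x.1 x.2 :=
        continuous_prod_of_discrete_right.2 M.continuous_orbit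
      exact h1.comp (continuous_fst.prodMk
        (f.continuous.comp (continuous_fst.inv.mul continuous_snd)))
    -- By currying, the orbit map G → C(G, M) is continuous, and its target is discrete.
    have h2 : IsLocallyConstant fun g => (ContinuousMap.curry ⟨_, h⟩ : C(G, C(G, M.V))) g :=
      (IsLocallyConstant.iff_continuous _).2 (ContinuousMap.continuous _)
    refine (IsLocallyConstant.iff_eventually_eq _).2 fun g => ?_
    filter_upwards [(IsLocallyConstant.iff_eventually_eq _).1 h2 g] with g' hg'
    exact LocallyConstant.ext fun x => congrArg (fun f : C(G, M.V) => f x) hg'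

/-- The quotient of a discrete module by a submodule. -/
noncomputable def quotient (W : Submodule (ZMod p) M.V) (hW : ∀ g, W ≤ W.comap (M.ρ g)) :
    DiscreteFpModule.{u} p G where
  V := M.V ⧸ W
  ρ := M.ρ.quotient W hW
  isLocallyConstant_orbit v := by
    obtain ⟨m, rfl⟩ := W.mkQ_surjective v
    exact (M.isLocallyConstant_orbit m).comp W.mkQ

section Coind

variable [IsTopologicalGroup G] [CompactSpace G]

/-- The inclusion of `M` in its coinduced module, as the constant functions. -/
noncomputable def constMap : M.V →ₗ[ZMod p] M.coind.V where
  toFun m := LocallyConstant.const G m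
  map_add' _ _ := rfl
  map_smul' _ _ := rfl

lemma constMap_ρ (g : G) (m : M.V) : M.constMap (M.ρ g m) = M.coind.ρ g (M.constMap m) := rfl

lemma constMap_injective : Function.Injective M.constMap := fun _ _ h =>
  congrArg (fun f : LocallyConstant G M.V => f 1) h

lemma range_constMap_le_comap (g : G) :
    LinearMap.range M.constMap ≤ (LinearMap.range M.constMap).comap (M.coind.ρ g) := by
  rintro _ ⟨m, rfl⟩
  exact ⟨M.ρ g m, M.constMap_ρ g m⟩

/-- The quotient of the coinduced module by the constant functions. -/
noncomputable abbrev cosyzygy : DiscreteFpModule.{u} p G :=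
  M.coind.quotient (LinearMap.range M.constMap) M.range_constMap_le_comap

/-- The projection from the coinduced module. -/
noncomputable def cosyzygyMap : M.coind.V →ₗ[ZMod p] M.cosyzygy.V :=
  (LinearMap.range M.constMap).mkQ

lemma cosyzygyMap_ρ (g : G) (m : M.coind.V) :
    M.cosyzygyMap (M.coind.ρ g m) = M.cosyzygy.ρ g (M.cosyzygyMap m) := rfl

lemma cosyzygyMap_surjective : Function.Surjective M.cosyzygyMap :=
  Submodule.mkQ_surjective _

lemma cosyzygyMap_eq_zero_iff (m : M.coind.V) :
    M.cosyzygyMap m = 0 ↔ ∃ m', M.constMap m' = m :=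
  Submodule.Quotient.mk_eq_zero _

/-- Evaluation on the diagonal, as an assembly operation on the coinduced module. -/
noncomputable def coindAssembly {Γ : Type u} [Group Γ] [TopologicalSpace Γ] (π : Γ →ₜ* G) :
    TopRep.Assembly π (TopRep.res (π : Γ →* G) (M.coind.twist χ k)) where
  toFun φ := (⟨fun g => (show LocallyConstant G M.V from φ g) g, by
    -- Near g the family φ is constant, and the function φ(g) is itself constant near g.
    refine (IsLocallyConstant.iff_eventually_eq _).2 fun g => ?_
    have h1 := (IsLocallyConstant.iff_eventually_eq _).1
      ((IsLocallyConstant.iff_continuous _).2 φ.continuous) g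
    have h2 := (IsLocallyConstant.iff_eventually_eq _).1
      (show LocallyConstant G M.V from φ g).isLocallyConstant g
    filter_upwards [h1, h2] with g' hg1 hg2
    exact (congrArg (fun f : LocallyConstant G M.V => f g') hg1).trans hg2⟩ : LocallyConstant G M.V)
  map_sub _ _ := rfl
  map_const _ := rfl
  equivariant γ φ ψ h := LocallyConstant.ext fun x =>
    (congrArg (fun f : LocallyConstant G M.V => f x) (h x)).symm

end Coind

end DiscreteFpModule

/-- A finite module as a discrete module. -/
def FpModule.toDiscrete [IsTopologicalGroup G] (M : FpModule.{u} p G) :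
    DiscreteFpModule.{u} p G where
  V := M.V
  ρ := M.ρ
  isLocallyConstant_orbit v := by
    -- The orbit map is constant on the open coset g · ker ρ.
    refine (IsLocallyConstant.iff_exists_open _).2 fun g => ⟨(fun x => g⁻¹ * x) ⁻¹' M.ρ.ker,
      M.isOpen_ker.preimage (continuous_const_mul g⁻¹), ?_, fun x hx => ?_⟩
    · change g⁻¹ * g ∈ M.ρ.ker
      rw [inv_mul_cancel]
      exact one_mem _
    · have h : M.ρ (g⁻¹ * x) = 1 := hx
      have h2 : M.ρ x = M.ρ g * M.ρ (g⁻¹ * x) := by rw [← map_mul, mul_inv_cancel_left]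
      rw [h2, h, mul_one]

end

/-! ### Inflation, restriction to the section and product with t on cochains -/

namespace DiscreteFpModule

open TopRep

variable {p : ℕ} [Fact p.Prime] {G : Type u} [Group G] [TopologicalSpace G] [IsTopologicalGroup G]

/-- The cocycle `(x, g) ↦ x` on `G((t))`. -/
noncomputable def tCocycle (χ : G →ₜ* ℤ_[p]ˣ) :
    Cocycle (TopRep.res (LaurentExt.proj χ : LaurentExt χ →* G) (zpTwist.{u} χ 1)) 1 :=
  Cocycle.ofCrossedHom _
    ⟨fun a => ULift.up a.coord, continuous_uliftUp.comp LaurentExt.continuous_coord⟩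
    (fun a b => ULift.ext _ _ (by
      change (a * b).coord = a.coord + ((χ a.base ^ (1 : ℤ) : ℤ_[p]ˣ) : ℤ_[p]) * b.coord
      rw [zpow_one, LaurentExt.coord_mul]))

variable (M : DiscreteFpModule.{u} p G) (χ : G →ₜ* ℤ_[p]ˣ) (k : ℤ)

/-- Inflation of cochains. -/
noncomputable def inflC (n : ℕ) : (homogeneousCochains (M.twist χ k)).X n →+
    (homogeneousCochains (M.laurentTwist χ k)).X n :=
  mapC (LaurentExt.proj χ) (𝟙 (M.laurentTwist χ k)) n

/-- Restriction of cochains along the section `G → G((t))`. -/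
noncomputable def secC (n : ℕ) : (homogeneousCochains (M.laurentTwist χ k)).X n →+
    (homogeneousCochains (M.twist χ k)).X n :=
  mapC (A := M.laurentTwist χ k) (LaurentExt.sec χ) (𝟙 (M.twist χ k)) n

/-- The composite G → G((t)) → G is the identity, so restriction retracts inflation already on
cochains. -/
lemma secC_inflC (n : ℕ) (F : (homogeneousCochains (M.twist χ k)).X n) :
    M.secC χ k n (M.inflC χ k n F) = F := by
  have h (n : ℕ) (x : (resolutionX (M.twist χ k) n).V) :
      mapX (A := M.laurentTwist χ k) (LaurentExt.sec χ) (𝟙 (M.twist χ k)) n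
        (mapX (LaurentExt.proj χ) (𝟙 (M.laurentTwist χ k)) n x) = x := by
    induction n with
    | zero => rfl
    | succ n ih =>
      exact ContinuousMap.ext fun g => ih ((show C(G, (resolutionX (M.twist χ k) n).V) from x) g)
  exact Subtype.ext (h (n + 1) F.1)

lemma dC_inflC (i j : ℕ) (F : (homogeneousCochains (M.twist χ k)).X i) :
    dC _ i j (M.inflC χ k i F) = M.inflC χ k j (dC _ i j F) := dC_mapC _ _ i j F

lemma dC_secC (i j : ℕ) (F : (homogeneousCochains (M.laurentTwist χ k)).X i) :
    dC _ i j (M.secC χ k i F) = M.secC χ k j (dC _ i j F) :=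
  dC_mapC (A := M.laurentTwist χ k) _ _ i j F

section Natural

variable {M χ} {G' : Type u} [Group G'] [TopologicalSpace G'] [IsTopologicalGroup G']
  {χ' : G' →ₜ* ℤ_[p]ˣ} {M' : DiscreteFpModule.{u} p G'} (φ : G' →ₜ* G) (hφ : ∀ g, χ (φ g) = χ' g)
  (f : M.V →ₗ[ZMod p] M'.V) (hf : ∀ g m, f (M.ρ (φ g) m) = M'.ρ g (f m))

lemma inflC_natural (n : ℕ) (F : (homogeneousCochains (M.twist χ k)).X n) :
    mapC (LaurentExt.map φ hφ) (laurentTwistMap k φ hφ f hf) n (M.inflC χ k n F) =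
      M'.inflC χ' k n (mapC φ (twistMap k φ hφ f hf) n F) := by
  have h (n : ℕ) (x : (resolutionX (M.twist χ k) n).V) :
      mapX (LaurentExt.map φ hφ) (laurentTwistMap k φ hφ f hf) n
        (mapX (LaurentExt.proj χ) (𝟙 (M.laurentTwist χ k)) n x) =
      mapX (LaurentExt.proj χ') (𝟙 (M'.laurentTwist χ' k)) n
        (mapX φ (twistMap k φ hφ f hf) n x) := by
    induction n with
    | zero => rfl
    | succ n ih =>
      exact ContinuousMap.ext fun g =>
        ih ((show C(G, (resolutionX (M.twist χ k) n).V) from x) (φ g.base))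
  exact Subtype.ext (h (n + 1) F.1)

end Natural

variable [CompactSpace G]

/-- The pairing `M(k - 1) × ℤ_p(1) → M(k)` of `G((t))`-modules. -/
noncomputable abbrev laurentPairing :
    Pairing (M.laurentTwist χ (k - 1))
      (TopRep.res (LaurentExt.proj χ : LaurentExt χ →* G) (zpTwist.{u} χ 1)) (M.laurentTwist χ k) :=
  (M.twistPairing χ k).res (LaurentExt.proj χ)

/-- The cup product with `t` of the inflation of a cochain. -/
noncomputable def cupC (n : ℕ) : (homogeneousCochains (M.twist χ (k - 1))).X n →+
    (homogeneousCochains (M.laurentTwist χ k)).X (1 + n) :=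
  AddMonoidHom.mk' (fun F => (M.laurentPairing χ k).cupCochain (M.inflC χ (k - 1) n F)
    (tCocycle χ).1) fun F F' => by
      rw [map_add]
      exact Subtype.ext ((M.laurentPairing χ k).cupX_add_left (tCocycle χ).1.1 n
        (M.inflC χ (k - 1) n F).1 (M.inflC χ (k - 1) n F').1)

lemma cupC_coe (n : ℕ) (F : (homogeneousCochains (M.twist χ (k - 1))).X n) :
    (M.cupC χ k n F).1 = (M.laurentPairing χ k).cupX (tCocycle χ).1.1 n
      (M.inflC χ (k - 1) n F).1 := rfl

/-- Leibniz rule with dt = 0; no sign appears because t is the right factor. -/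
lemma dC_cupC (i j : ℕ) (F : (homogeneousCochains (M.twist χ (k - 1))).X i) :
    dC _ (1 + i) (1 + j) (M.cupC χ k i F) = M.cupC χ k j (dC _ i j F) := by
  by_cases hij : i + 1 = j
  · subst hij
    refine Subtype.ext ((dC_coe _ (1 + i) _).trans ?_)
    refine ((M.laurentPairing χ k).dX_cupX (tCocycle χ).1.1 i (M.inflC χ (k - 1) i F).1).trans ?_
    have hE := (mem_cocycle_iff (tCocycle χ).1).1 (tCocycle χ).2
    have h2 : (M.laurentPairing χ k).cupX (dX _ 2 (tCocycle χ).1.1) i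
        (M.inflC χ (k - 1) i F).1 = 0 := by
      refine Eq.trans (congrArg (fun E => (M.laurentPairing χ k).cupX (j := 2) E i
        (M.inflC χ (k - 1) i F).1) hE) ?_
      exact (M.laurentPairing χ k).cupX_zero_right i (M.inflC χ (k - 1) i F).1
    rw [h2, castX_zero, smul_zero, add_zero, cupC_coe, ← dC_inflC]
    exact congrArg ((M.laurentPairing χ k).cupX (tCocycle χ).1.1 (i + 1)) (dC_coe _ i _).symm
  · rw [dC_of_ne _ hij, map_zero, dC_of_ne _ (by omega)]

/-- The cocycle t vanishes on the section, whose elements have ℤ_p(1)-coordinate 0. -/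
lemma secC_cupC (n : ℕ) (F : (homogeneousCochains (M.twist χ (k - 1))).X n) :
    M.secC χ k (1 + n) (M.cupC χ k n F) = 0 := by
  refine Subtype.ext ?_
  refine ((M.laurentPairing χ k).mapX_cupX (M.twistPairing χ k) (LaurentExt.sec χ)
    (𝟙 (M.twist χ (k - 1))) (𝟙 (zpTwist.{u} χ 1)) (𝟙 (M.twist χ k)) (fun _ _ => rfl)
    (tCocycle χ).1.1 n (M.inflC χ (k - 1) n F).1).trans ?_
  have hT : mapX (A := TopRep.res (LaurentExt.proj χ : LaurentExt χ →* G) (zpTwist.{u} χ 1))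
      (LaurentExt.sec χ) (𝟙 (zpTwist.{u} χ 1)) 2 (tCocycle χ).1.1 = 0 :=
    ContinuousMap.ext fun x => ContinuousMap.ext fun y => sub_self (ULift.up.{u} (0 : ℤ_[p]))
  refine Eq.trans (congrArg (fun E => (M.twistPairing χ k).cupX (j := 1) E n _) hT) ?_
  exact (M.twistPairing χ k).cupX_zero_right n _

section Natural

variable {M χ} {G' : Type u} [Group G'] [TopologicalSpace G'] [IsTopologicalGroup G']
  [CompactSpace G']
  {χ' : G' →ₜ* ℤ_[p]ˣ} {M' : DiscreteFpModule.{u} p G'} (φ : G' →ₜ* G) (hφ : ∀ g, χ (φ g) = χ' g)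
  (f : M.V →ₗ[ZMod p] M'.V) (hf : ∀ g m, f (M.ρ (φ g) m) = M'.ρ g (f m))

/-- The identity of `ℤ_p`, as a map of twists. -/
noncomputable def zpTwistMap (i : ℤ) :
    TopRep.res (φ : G' →* G) (zpTwist.{u} χ i) ⟶ zpTwist.{u} χ' i :=
  TopRep.ofHom
    { toFun := id
      map_add' := fun _ _ => rfl
      map_smul' := fun _ _ => rfl
      cont := continuous_id
      isIntertwining' := fun g => by
        ext x
        change ((χ (φ g) ^ i : ℤ_[p]ˣ) : ℤ_[p]) * x.down = ((χ' g ^ i : ℤ_[p]ˣ) : ℤ_[p]) * x.down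
        rw [hφ] }

/-- The map G'((t)) → G((t)) preserves the ℤ_p-coordinate, hence pulls the cocycle t back to t. -/
lemma cupC_natural (n : ℕ) (F : (homogeneousCochains (M.twist χ (k - 1))).X n) :
    mapC (LaurentExt.map φ hφ) (laurentTwistMap k φ hφ f hf) (1 + n) (M.cupC χ k n F) =
      M'.cupC χ' k n (mapC φ (twistMap (k - 1) φ hφ f hf) n F) := by
  refine Subtype.ext ?_
  refine ((M.laurentPairing χ k).mapX_cupX (M'.laurentPairing χ' k) (LaurentExt.map φ hφ)
    (laurentTwistMap (k - 1) φ hφ f hf)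
    ((TopRep.resFunctor (LaurentExt.proj χ' : LaurentExt χ' →* G')).map (zpTwistMap φ hφ 1))
    (laurentTwistMap k φ hφ f hf) (fun a b => f.map_smul (PadicInt.toZMod b.down) a)
    (tCocycle χ).1.1 n (M.inflC χ (k - 1) n F).1).trans ?_
  rw [cupC_coe, ← inflC_natural]
  rfl

end Natural

end DiscreteFpModule

/-! ### The decomposition in degree one -/

namespace DiscreteFpModule

open TopRep

variable {p : ℕ} [Fact p.Prime] {G : Type u} [Group G] [TopologicalSpace G]
  (M : DiscreteFpModule.{u} p G) (χ : G →ₜ* ℤ_[p]ˣ) (k : ℤ)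

lemma laurentTwist_ρ_of_proj_eq_one (γ : LaurentExt χ) (hγ : LaurentExt.proj χ γ = 1) (m : M.V) :
    (M.laurentTwist χ k).ρ γ m = m := by
  change (M.twist χ k).ρ (LaurentExt.proj χ γ) m = m
  rw [hγ]
  exact congr($(map_one (M.twist χ k).ρ) m)

section Coeff

variable [IsTopologicalGroup G]

variable {M} {M' : DiscreteFpModule.{u} p G} (f : M.V →ₗ[ZMod p] M'.V)
  (hf : ∀ g m, f (M.ρ g m) = M'.ρ g (f m))
/-- The map `M(k) → M'(k)` induced by a `G`-equivariant map `M → M'`. -/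
noncomputable abbrev coeffTwist : M.twist χ k ⟶ M'.twist χ k :=
  twistMap k (ContinuousMonoidHom.id G) (fun _ => rfl) f hf

/-- The map `M(k) → M'(k)` of `G((t))`-modules induced by a `G`-equivariant map `M → M'`. -/
noncomputable abbrev laurentCoeffTwist : M.laurentTwist χ k ⟶ M'.laurentTwist χ k :=
  (TopRep.resFunctor (LaurentExt.proj χ : LaurentExt χ →* G)).map (coeffTwist χ k f hf)

lemma coeffC_inflC (n : ℕ) (F : (homogeneousCochains (M.twist χ k)).X n) :
    coeffC (laurentCoeffTwist χ k f hf) n (M.inflC χ k n F) =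
      M'.inflC χ k n (coeffC (coeffTwist χ k f hf) n F) :=
  inflC_natural k (ContinuousMonoidHom.id G) (fun _ => rfl) f hf n F

lemma coeffC_cupC [CompactSpace G] (n : ℕ) (F : (homogeneousCochains (M.twist χ (k - 1))).X n) :
    coeffC (laurentCoeffTwist χ k f hf) (1 + n) (M.cupC χ k n F) =
      M'.cupC χ k n (coeffC (coeffTwist χ (k - 1) f hf) n F) :=
  cupC_natural k (ContinuousMonoidHom.id G) (fun _ => rfl) f hf n F

end Coeff

variable [IsTopologicalGroup G] [CompactSpace G]

/-- Every `1`-cocycle of `G((t))` is the sum of an inflated cocycle and a product with `t`. -/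
lemma exists_inflC_add_cupC_one (F : (homogeneousCochains (M.laurentTwist χ k)).X 1)
    (hF : dC _ 1 2 F = 0) :
    ∃ b, dC (M.twist χ (k - 1)) 0 1 b = 0 ∧
      F = M.inflC χ k 1 (M.secC χ k 1 F) + M.cupC χ k 0 b := by
  let F' : C(LaurentExt χ, C(LaurentExt χ, M.V)) := F.1
  -- The associated inhomogeneous cocycle: dF = 0 gives F(x, y) = c(y) - c(x), and invariance of F
  -- gives the crossed homomorphism law.
  let c : C(LaurentExt χ, M.V) := F' 1
  have hFc (x y : LaurentExt χ) : F' x y = c y - c x := by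
    have h : dX _ 2 F.1 = 0 := (dC_coe _ 1 F).symm.trans (congrArg Subtype.val hF)
    have h' : F' x y - (F' 1 y - F' 1 x) = 0 :=
      congrArg (fun f : C(LaurentExt χ, C(LaurentExt χ, C(LaurentExt χ, M.V))) => f 1 x y) h
    exact sub_eq_zero.1 h'
  have hc (γ δ : LaurentExt χ) : c (γ * δ) = c γ + (show M.V from (M.laurentTwist χ k).ρ γ (c δ)) := by
    have h : (M.laurentTwist χ k).ρ γ (F' (γ⁻¹ * γ) (γ⁻¹ * (γ * δ))) = F' γ (γ * δ) :=
      congrArg (fun f : C(LaurentExt χ, C(LaurentExt χ, M.V)) => f γ (γ * δ)) (F.2 γ)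
    rw [inv_mul_cancel, inv_mul_cancel_left, hFc γ] at h
    exact eq_add_of_sub_eq' h.symm
  let b₀ : M.V := c (LaurentExt.pair χ 1 1)
  have hadd (x : ℤ_[p]) (γ : LaurentExt χ) :
      c (LaurentExt.pair χ x 1 * γ) = c (LaurentExt.pair χ x 1) + c γ := by
    rw [hc]
    exact congrArg _ (M.laurentTwist_ρ_of_proj_eq_one χ k _ rfl _)
  -- As ℤ_p(1) acts trivially on M(k), c is additive there; the formula holds on ℕ and extends by
  -- density.
  have hx (x : ℤ_[p]) : c (LaurentExt.pair χ x 1) = PadicInt.toZMod x • b₀ := by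
    have hcont : Continuous fun x : ℤ_[p] => (PadicInt.toZMod x • b₀ : M.V) :=
      (continuous_of_discreteTopology (f := fun z : ZMod p => (z • b₀ : M.V))).comp
        continuous_toZMod
    refine PadicInt.denseRange_natCast.induction_on (p := fun x : ℤ_[p] =>
      c (LaurentExt.pair χ x 1) = PadicInt.toZMod x • b₀) x
      (isClosed_eq (c.continuous.comp (LaurentExt.continuous_pair.comp
        (continuous_id.prodMk continuous_const))) hcont) fun n => ?_
    induction n with
    | zero =>
      have h := hadd 0 1
      rw [mul_one, LaurentExt.pair_zero_one, left_eq_add] at h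
      rw [Nat.cast_zero, LaurentExt.pair_zero_one, h, map_zero, zero_smul]
    | succ n ih =>
      rw [Nat.cast_succ, LaurentExt.pair_add, hadd, ih, map_add, map_one, add_smul, one_smul]
  -- Evaluating c on both sides of (0, g)(1, 1) = (χ(g), 1)(0, g) shows that g sends b₀ to χ(g)b₀ in
  -- M(k). Cancelling χ(g) gives invariance in M(k - 1), which is where the twist drops by one.
  have hinv (g : G) : (M.twist χ (k - 1)).ρ g b₀ = b₀ := by
    have h := hc (LaurentExt.sec χ g) (LaurentExt.pair χ 1 1)
    rw [LaurentExt.sec_mul_pair, hadd, hx, add_comm, add_right_inj, mul_one] at h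
    have h1 : FpModule.modChar χ 1 g • b₀ =
        FpModule.modChar χ 1 g • (FpModule.modChar χ (k - 1) g • M.ρ g b₀) := by
      rw [smul_smul, mul_comm, ← FpModule.modChar_sub_one_mul, FpModule.modChar_eq, zpow_one]
      exact h
    have hne : FpModule.modChar χ 1 g ≠ 0 := Units.ne_zero _
    exact (smul_right_injective M.V hne h1).symm
  refine ⟨⟨ContinuousMap.const G b₀, fun g => ContinuousMap.ext fun _ => hinv g⟩,
    Subtype.ext ((dC_coe _ 0 _).trans ?_), Subtype.ext ?_⟩
  · exact ContinuousMap.ext fun _ => ContinuousMap.ext fun _ => sub_self b₀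
  -- Split z as (coord z, 1) times the section at base z: the first factor contributes the product
  -- with t, the second the inflated restriction.
  · refine ContinuousMap.ext fun x => ContinuousMap.ext fun y => ?_
    change F' x y = F' (LaurentExt.sec χ x.base) (LaurentExt.sec χ y.base) +
      (PadicInt.toZMod (y.coord - x.coord) • b₀ : M.V)
    have h (z : LaurentExt χ) :
        c z = PadicInt.toZMod z.coord • b₀ + c (LaurentExt.sec χ z.base) := by
      rw [← hx, ← hadd, LaurentExt.pair_mul_sec, LaurentExt.pair_coord_base]
    rw [hFc x y, hFc (LaurentExt.sec χ x.base), h x, h y, map_sub, sub_smul]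
    abel

/-- At the pair (1, σ), with σ the generator of ℤ_p(1), the product b ∪ t takes the value b(1). A
coboundary vanishes there because σ acts trivially on M(k); for i ≠ 0 the differential into degree 1
is zero by convention. Invariance spreads b(1) = 0 to all of b. -/
lemma eq_zero_of_cupC_zero_eq (b : (homogeneousCochains (M.twist χ (k - 1))).X 0) (i : ℕ)
    (W : (homogeneousCochains (M.laurentTwist χ k)).X i) (h : M.cupC χ k 0 b = dC _ i 1 W) :
    b = 0 := by
  let b' : C(G, M.V) := b.1
  have h1 : (show C(LaurentExt χ, C(LaurentExt χ, M.V)) from (dC _ i 1 W).1) 1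
      (LaurentExt.pair χ 1 1) = 0 := by
    by_cases hi : i = 0
    · subst hi
      rw [dC_coe]
      let W' : C(LaurentExt χ, M.V) := W.1
      change W' (LaurentExt.pair χ 1 1) - W' 1 = 0
      have h2 : W' (LaurentExt.pair χ 1 1) = (M.laurentTwist χ k).ρ (LaurentExt.pair χ 1 1) (W' 1) :=
        cochain_apply W (LaurentExt.pair χ 1 1)
      rw [h2]
      exact sub_eq_zero.2 (M.laurentTwist_ρ_of_proj_eq_one χ k _ rfl _)
    · rw [dC_of_ne _ (by omega)]
      rfl
  rw [← h] at h1
  have h3 : (PadicInt.toZMod (1 - 0 : ℤ_[p]) • b' 1 : M.V) = 0 := h1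
  rw [sub_zero, map_one, one_smul] at h3
  refine Subtype.ext (ContinuousMap.ext fun g => (cochain_apply b g).trans ?_)
  change (M.twist χ (k - 1)).ρ g (b' 1) = 0
  rw [h3]
  exact map_zero _

end DiscreteFpModule

/-! ### Dimension shifting -/

namespace DiscreteFpModule

open TopRep

variable {p : ℕ} [Fact p.Prime] {G : Type u} [Group G] [TopologicalSpace G]
  [IsTopologicalGroup G] [CompactSpace G] (M : DiscreteFpModule.{u} p G) (χ : G →ₜ* ℤ_[p]ˣ) (k : ℤ)

lemma exists_dC_eq_coind (n : ℕ) (z : (homogeneousCochains (M.coind.twist χ k)).X (n + 1))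
    (hz : dC _ (n + 1) (n + 2) z = 0) : ∃ W, dC (M.coind.twist χ k) n (n + 1) W = z :=
  exists_dC_eq_of_assembly (M.coindAssembly χ k (ContinuousMonoidHom.id G)) n z hz

/-- By Shapiro this is the cohomology of ℤ_p(1) in M, zero from degree two on. In degree one it is M
itself, hence the bound on n. -/
lemma exists_dC_eq_laurent_coind (n : ℕ) (hn : 1 ≤ n)
    (z : (homogeneousCochains (M.coind.laurentTwist χ k)).X (n + 1))
    (hz : dC _ (n + 1) (n + 2) z = 0) : ∃ W, dC (M.coind.laurentTwist χ k) n (n + 1) W = z := by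
  obtain ⟨j, rfl⟩ := Nat.exists_eq_add_of_le' hn
  exact LaurentExt.exists_dC_eq_of_assembly _ M.coind.nsmul_eq_zero
    (M.coindAssembly χ k (LaurentExt.proj χ)) j z hz

/-- The map `M(k) → I(k)` to the coinduced module. -/
noncomputable abbrev ι : M.twist χ k ⟶ M.coind.twist χ k :=
  coeffTwist χ k M.constMap M.constMap_ρ

/-- The map `I(k) → (I/M)(k)` from the coinduced module. -/
noncomputable abbrev q : M.coind.twist χ k ⟶ M.cosyzygy.twist χ k :=
  coeffTwist χ k M.cosyzygyMap M.cosyzygyMap_ρ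

/-- `ι` as a map of `G((t))`-modules. -/
noncomputable abbrev ιL : M.laurentTwist χ k ⟶ M.coind.laurentTwist χ k :=
  laurentCoeffTwist χ k M.constMap M.constMap_ρ

/-- `q` as a map of `G((t))`-modules. -/
noncomputable abbrev qL : M.coind.laurentTwist χ k ⟶ M.cosyzygy.laurentTwist χ k :=
  laurentCoeffTwist χ k M.cosyzygyMap M.cosyzygyMap_ρ

lemma cosyzygyMap_constMap (m : M.V) : M.cosyzygyMap (M.constMap m) = 0 :=
  (M.cosyzygyMap_eq_zero_iff _).2 ⟨m, rfl⟩

lemma exists_ι_eq {n : ℕ} {F : (homogeneousCochains (M.coind.twist χ k)).X n}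
    (hF : coeffC (M.q χ k) n F = 0) : ∃ E, coeffC (M.ι χ k) n E = F :=
  coeffC_exact _ _ M.constMap_injective (fun m h => (M.cosyzygyMap_eq_zero_iff m).1 h) n F hF

lemma exists_ιL_eq {n : ℕ} {F : (homogeneousCochains (M.coind.laurentTwist χ k)).X n}
    (hF : coeffC (M.qL χ k) n F = 0) : ∃ E, coeffC (M.ιL χ k) n E = F :=
  coeffC_exact _ _ M.constMap_injective (fun m h => (M.cosyzygyMap_eq_zero_iff m).1 h) n F hF

lemma ι_injective (n : ℕ) : Function.Injective (coeffC (M.ι χ k) n) :=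
  coeffC_injective _ M.constMap_injective n

lemma ιL_injective (n : ℕ) : Function.Injective (coeffC (M.ιL χ k) n) :=
  coeffC_injective _ M.constMap_injective n

lemma q_surjective (n : ℕ) : Function.Surjective (coeffC (M.q χ k) n) :=
  coeffC_surjective _ M.cosyzygyMap_surjective n

lemma qL_surjective (n : ℕ) : Function.Surjective (coeffC (M.qL χ k) n) :=
  coeffC_surjective _ M.cosyzygyMap_surjective n

lemma q_ι {n : ℕ} (F : (homogeneousCochains (M.twist χ k)).X n) :
    coeffC (M.q χ k) n (coeffC (M.ι χ k) n F) = 0 :=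
  coeffC_coeffC_eq_zero _ _ M.cosyzygyMap_constMap n F

lemma qL_ιL {n : ℕ} (F : (homogeneousCochains (M.laurentTwist χ k)).X n) :
    coeffC (M.qL χ k) n (coeffC (M.ιL χ k) n F) = 0 :=
  coeffC_coeffC_eq_zero _ _ M.cosyzygyMap_constMap n F

/-- A cochain of the coinduced module lifting a cocycle of the quotient has a coboundary in `M`. -/
lemma exists_ι_eq_dC {n : ℕ} (F : (homogeneousCochains (M.coind.twist χ k)).X n)
    (hF : dC _ n (n + 1) (coeffC (M.q χ k) n F) = 0) :
    ∃ E, coeffC (M.ι χ k) (n + 1) E = dC _ n (n + 1) F ∧ dC _ (n + 1) (n + 2) E = 0 := by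
  obtain ⟨E, hE⟩ := M.exists_ι_eq χ k (F := dC _ n (n + 1) F) (by rw [← dC_coeffC, hF])
  refine ⟨E, hE, M.ι_injective χ k _ ?_⟩
  rw [← dC_coeffC, hE, dC_dC, map_zero]

/-- `cupC` in positive degrees. -/
noncomputable def cupCSucc (n : ℕ) : (homogeneousCochains (M.twist χ (k - 1))).X (n + 1) →+
    (homogeneousCochains (M.laurentTwist χ k)).X (1 + n + 1) :=
  M.cupC χ k (n + 1)

/-- Phrases the Leibniz rule with degree 1 + n + 1 in place of the definitionally equal 1 + (n + 1),
so that it can be used for rewriting. -/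
lemma dC_cupC_succ (n : ℕ) (F : (homogeneousCochains (M.twist χ (k - 1))).X n) :
    dC _ (1 + n) (1 + n + 1) (M.cupC χ k n F) = M.cupCSucc χ k n (dC _ n (n + 1) F) :=
  M.dC_cupC χ k n (n + 1) F

lemma ιL_inflC (n : ℕ) (F : (homogeneousCochains (M.twist χ k)).X n) :
    coeffC (M.ιL χ k) n (M.inflC χ k n F) = M.coind.inflC χ k n (coeffC (M.ι χ k) n F) :=
  coeffC_inflC χ k M.constMap M.constMap_ρ n F

lemma qL_inflC (n : ℕ) (F : (homogeneousCochains (M.coind.twist χ k)).X n) :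
    coeffC (M.qL χ k) n (M.coind.inflC χ k n F) = M.cosyzygy.inflC χ k n (coeffC (M.q χ k) n F) :=
  coeffC_inflC χ k M.cosyzygyMap M.cosyzygyMap_ρ n F

lemma qL_cupC (n : ℕ) (F : (homogeneousCochains (M.coind.twist χ (k - 1))).X n) :
    coeffC (M.qL χ k) (1 + n) (M.coind.cupC χ k n F) =
      M.cosyzygy.cupC χ k n (coeffC (M.q χ (k - 1)) n F) :=
  coeffC_cupC χ k M.cosyzygyMap M.cosyzygyMap_ρ n F

lemma ιL_cupCSucc (n : ℕ) (F : (homogeneousCochains (M.twist χ (k - 1))).X (n + 1)) :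
    coeffC (M.ιL χ k) (1 + n + 1) (M.cupCSucc χ k n F) =
      M.coind.cupCSucc χ k n (coeffC (M.ι χ (k - 1)) (n + 1) F) :=
  coeffC_cupC χ k M.constMap M.constMap_ρ (n + 1) F

/-- Every cocycle of `G((t))` in positive degree is cohomologous to the sum of an inflated cocycle
and the product of an inflated cocycle with `t`. -/
lemma exists_inflC_add_cupC (n : ℕ) (M : DiscreteFpModule.{u} p G)
    (F : (homogeneousCochains (M.laurentTwist χ k)).X (1 + n))
    (hF : dC _ (1 + n) (1 + n + 1) F = 0) :
    ∃ a b i W, dC (M.twist χ k) (1 + n) (1 + n + 1) a = 0 ∧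
      dC (M.twist χ (k - 1)) n (n + 1) b = 0 ∧
      F = M.inflC χ k (1 + n) a + M.cupC χ k n b + dC (M.laurentTwist χ k) i (1 + n) W := by
  induction n generalizing M with
  | zero =>
    obtain ⟨b, hb, h⟩ := M.exists_inflC_add_cupC_one χ k F hF
    refine ⟨M.secC χ k 1 F, b, 0, 0, ?_, hb, ?_⟩
    · refine (M.dC_secC χ k 1 2 F).trans ?_
      have hF' : dC (M.laurentTwist χ k) 1 2 F = 0 := hF
      rw [hF', map_zero]
    · exact h.trans ((congrArg _ (map_zero _)).trans (add_zero _)).symm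
  | succ n ih =>
    -- The same change of degree from 1 + (n + 1) to 1 + n + 1, with the index of the coboundary now
    -- fixed.
    suffices h : ∀ F : (homogeneousCochains (M.laurentTwist χ k)).X (1 + n + 1),
        dC _ (1 + n + 1) (1 + n + 2) F = 0 →
        ∃ a b W, dC (M.twist χ k) (1 + n + 1) (1 + n + 2) a = 0 ∧
          dC (M.twist χ (k - 1)) (n + 1) (n + 2) b = 0 ∧
          F = M.inflC χ k (1 + n + 1) a + M.cupCSucc χ k n b +
            dC (M.laurentTwist χ k) (1 + n) (1 + n + 1) W by
      obtain ⟨a, b, W, ha, hb, h⟩ := h F hF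
      exact ⟨a, b, 1 + n, W, ha, hb, h⟩
    intro F hF
    -- In I the cocycle F becomes dE, so the image of E in I/M is a cocycle one degree lower, to
    -- which the induction applies.
    obtain ⟨E, hE⟩ := M.exists_dC_eq_laurent_coind χ k (1 + n) (Nat.le_add_right 1 n)
      (coeffC (M.ιL χ k) (1 + n + 1) F) (by rw [dC_coeffC, hF, map_zero])
    obtain ⟨a', b', i, W', ha', hb', h'⟩ := ih M.cosyzygy (coeffC (M.qL χ k) (1 + n) E) (by
      rw [dC_coeffC, hE, qL_ιL])
    obtain ⟨a₁, rfl⟩ := M.q_surjective χ k _ a'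
    obtain ⟨b₁, rfl⟩ := M.q_surjective χ (k - 1) _ b'
    obtain ⟨W₁, rfl⟩ := M.qL_surjective χ k _ W'
    -- Here a, and b below, are obtained by the connecting homomorphism: lift to I, differentiate,
    -- and land in M.
    obtain ⟨a, ha, hda⟩ := M.exists_ι_eq_dC χ k a₁ ha'
    obtain ⟨b, hb, hdb⟩ := M.exists_ι_eq_dC χ (k - 1) b₁ hb'
    -- E minus the lifted decomposition dies in I/M, hence comes from a cochain W of M;
    -- differentiating this relation gives the decomposition of F.
    obtain ⟨W, hW⟩ := M.exists_ιL_eq χ k (F := E - (M.coind.inflC χ k (1 + n) a₁ +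
      M.coind.cupC χ k n b₁ + dC (M.coind.laurentTwist χ k) i (1 + n) W₁)) (by
        rw [map_sub, map_add, map_add, qL_inflC, qL_cupC, ← dC_coeffC, h', sub_self])
    refine ⟨a, b, W, hda, hdb, M.ιL_injective χ k _ ?_⟩
    have h2 := congrArg (dC (M.coind.laurentTwist χ k) (1 + n) (1 + n + 1)) hW
    rw [dC_coeffC, map_sub, hE, map_add, map_add, dC_inflC, dC_cupC_succ, dC_dC, add_zero, ← ha,
      ← hb] at h2
    rw [map_add, map_add, ιL_inflC, ιL_cupCSucc, h2, add_sub_cancel]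

/-- A cocycle of `G` is a coboundary if the product of its inflation with `t` is a coboundary. -/
lemma exists_dC_eq_of_cupC_eq (n : ℕ) (M : DiscreteFpModule.{u} p G)
    (b : (homogeneousCochains (M.twist χ (k - 1))).X n) (hb : dC _ n (n + 1) b = 0) (i : ℕ)
    (W : (homogeneousCochains (M.laurentTwist χ k)).X i)
    (h : M.cupC χ k n b = dC _ i (1 + n) W) : ∃ j V, dC (M.twist χ (k - 1)) j n V = b := by
  induction n generalizing M i with
  | zero => exact ⟨0, 0, (map_zero _).trans (M.eq_zero_of_cupC_zero_eq χ k b i W h).symm⟩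
  | succ n ih =>
    -- Only i = 1 + n carries a nonzero differential into this degree; otherwise W = 0 serves.
    obtain ⟨W, h⟩ : ∃ W, M.cupCSucc χ k n b = dC (M.laurentTwist χ k) (1 + n) (1 + n + 1) W := by
      by_cases hi : i = 1 + n
      · subst hi
        exact ⟨W, h⟩
      · exact ⟨0, (h.trans (dC_of_ne _ (by omega) W)).trans (map_zero _).symm⟩
    obtain ⟨b₁, hb₁⟩ := M.exists_dC_eq_coind χ (k - 1) n (coeffC (M.ι χ (k - 1)) (n + 1) b)
      (by rw [dC_coeffC, hb, map_zero])
    -- In I, the product b₁ ∪ t and the image of W have equal differentials. Their difference is a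
    -- cocycle, possibly of degree one where I has cohomology, so it is decomposed rather than
    -- bounded.
    obtain ⟨a, b₂, i₂, W₂, ha, hb₂, h₂⟩ := exists_inflC_add_cupC χ k n M.coind
      (M.coind.cupC χ k n b₁ - coeffC (M.ιL χ k) (1 + n) W) (by
        rw [map_sub, dC_cupC_succ, hb₁, dC_coeffC, ← h, ιL_cupCSucc, sub_self])
    have h₃ := congrArg (coeffC (M.qL χ k) (1 + n)) h₂
    rw [map_sub, map_add, map_add, qL_inflC, qL_cupC, qL_cupC, qL_ιL, sub_zero, ← dC_coeffC] at h₃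
    -- Restriction to the section removes the products with t and shows that the image of a in I/M
    -- is a coboundary.
    have h₄ := congrArg (M.cosyzygy.secC χ k (1 + n)) h₃
    rw [map_add, map_add, secC_cupC, secC_cupC, secC_inflC, add_zero, ← dC_secC] at h₄
    -- So the image of b₁ - b₂ in I/M is a cocycle whose product with t is a coboundary.
    obtain ⟨j, V', hV'⟩ := ih M.cosyzygy (coeffC (M.q χ (k - 1)) n (b₁ - b₂)) (by
        rw [dC_coeffC, map_sub, hb₁, hb₂, sub_zero, q_ι]) i₂
      (coeffC (M.qL χ k) i₂ W₂ - M.cosyzygy.inflC χ k i₂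
        (M.cosyzygy.secC χ k i₂ (coeffC (M.qL χ k) i₂ W₂))) (by
        rw [map_sub, map_sub, map_sub, h₃, dC_inflC, eq_neg_of_add_eq_zero_left h₄.symm, map_neg]
        abel)
    obtain ⟨V₁, rfl⟩ := M.q_surjective χ (k - 1) _ V'
    -- The cochain b₁ - b₂ - dV₁ comes from M and has the same differential as b₁, namely the image
    -- of b; hence de = b.
    obtain ⟨e, he⟩ := M.exists_ι_eq χ (k - 1) (F := b₁ - b₂ - dC _ j n V₁) (by
      rw [map_sub, ← dC_coeffC, hV', sub_self])
    refine ⟨n, e, M.ι_injective χ (k - 1) _ ?_⟩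
    rw [← dC_coeffC, he, map_sub, map_sub, dC_dC, hb₁, hb₂, sub_zero, sub_zero]

end DiscreteFpModule

/-! ### Passage to cohomology classes and the residue map -/

section

open TopRep

variable {p : ℕ} [Fact p.Prime] {G : Type u} [Group G] [TopologicalSpace G]
  [IsTopologicalGroup G]

namespace DiscreteFpModule

variable [CompactSpace G] (M : DiscreteFpModule.{u} p G) (χ : G →ₜ* ℤ_[p]ˣ) (k : ℤ) (n : ℕ)

/-- Restriction to the section isolates a as a coboundary. Subtracting from W the inflation of its
restriction leaves a primitive of b ∪ t alone. -/
lemma exists_dC_eq_of_inflC_add_cupC (a : (homogeneousCochains (M.twist χ k)).X (1 + n))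
    (b : (homogeneousCochains (M.twist χ (k - 1))).X n) (hb : dC _ n (n + 1) b = 0) (i : ℕ)
    (W : (homogeneousCochains (M.laurentTwist χ k)).X i)
    (h : dC _ i (1 + n) W = M.inflC χ k (1 + n) a + M.cupC χ k n b) :
    (∃ j V, dC (M.twist χ k) j (1 + n) V = a) ∧ ∃ j V, dC (M.twist χ (k - 1)) j n V = b := by
  have h2 := congrArg (M.secC χ k (1 + n)) h
  rw [map_add, secC_inflC, secC_cupC, add_zero, ← dC_secC] at h2
  refine ⟨⟨i, _, h2⟩,
    exists_dC_eq_of_cupC_eq χ k n M b hb i (W - M.inflC χ k i (M.secC χ k i W)) ?_⟩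
  rw [map_sub, h, dC_inflC, h2, add_sub_cancel_left]

lemma exists_dC_eq_inflC_add_cupC_sub (F : (homogeneousCochains (M.laurentTwist χ k)).X (1 + n))
    (hF : dC _ (1 + n) (1 + n + 1) F = 0) :
    ∃ a b, dC (M.twist χ k) (1 + n) (1 + n + 1) a = 0 ∧ dC (M.twist χ (k - 1)) n (n + 1) b = 0 ∧
      ∃ i W, dC (M.laurentTwist χ k) i (1 + n) W =
        M.inflC χ k (1 + n) a + M.cupC χ k n b - F := by
  obtain ⟨a, b, i, W, ha, hb, h⟩ := exists_inflC_add_cupC χ k n M F hF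
  exact ⟨a, b, ha, hb, i, -W, by rw [map_neg, h, sub_add_cancel_left]⟩

end DiscreteFpModule

namespace FpModule

/-- Inflation of cocycles. -/
noncomputable def inflCocycle (M : FpModule.{u} p G) (χ : G →ₜ* ℤ_[p]ˣ) (k : ℤ) (n : ℕ)
    (F : Cocycle (M.twist χ k) n) : Cocycle (M.laurentTwist χ k) n :=
  mapCocycle (LaurentExt.proj χ) (𝟙 (M.laurentTwist χ k)) n F

lemma infl_cocycleClass (M : FpModule.{u} p G) (χ : G →ₜ* ℤ_[p]ˣ) (k : ℤ) (n : ℕ)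
    (F : Cocycle (M.twist χ k) n) :
    M.infl χ k n (cocycleClass _ n F) = cocycleClass _ n (M.inflCocycle χ k n F) :=
  map_cocycleClass (LaurentExt.proj χ) (𝟙 (M.laurentTwist χ k)) n F

section Compact

variable [CompactSpace G]

/-- The cup product of an inflated cocycle with `t`. -/
noncomputable def cupCocycle (M : FpModule.{u} p G) (χ : G →ₜ* ℤ_[p]ˣ) (k : ℤ) (n : ℕ)
    (F : Cocycle (M.twist χ (k - 1)) n) : Cocycle (M.laurentTwist χ k) (1 + n) :=
  ((M.twistPairing χ k).res (LaurentExt.proj χ)).cupCocycle (M.inflCocycle χ (k - 1) n F)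
    (DiscreteFpModule.tCocycle χ)

lemma cupT_cocycleClass (M : FpModule.{u} p G) (χ : G →ₜ* ℤ_[p]ˣ) (k : ℤ) (n : ℕ)
    (F : Cocycle (M.twist χ (k - 1)) n) :
    M.cupT χ k n (cocycleClass _ n F) = cocycleClass _ (1 + n) (M.cupCocycle χ k n F) := by
  refine Eq.trans (congrArg (fun x => ((M.twistPairing χ k).res (LaurentExt.proj χ)).cup n 1 x
    (LaurentExt.tClass χ)) (M.infl_cocycleClass χ (k - 1) n F)) ?_
  exact Pairing.cup_cls _ (M.inflCocycle χ (k - 1) n F) (DiscreteFpModule.tCocycle χ)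

lemma infl_add_cupT_injective (M : FpModule.{u} p G) (χ : G →ₜ* ℤ_[p]ˣ) (k : ℤ) (n : ℕ)
    (x : continuousCohomology (1 + n) (M.twist χ k))
    (y : continuousCohomology n (M.twist χ (k - 1)))
    (h : M.infl χ k (1 + n) x + M.cupT χ k n y = 0) : x = 0 ∧ y = 0 := by
  obtain ⟨a, rfl⟩ := TopModuleCat.cls_surjective _ _ x
  obtain ⟨b, rfl⟩ := TopModuleCat.cls_surjective _ _ y
  change M.infl χ k (1 + n) (cocycleClass _ _ a) + M.cupT χ k n (cocycleClass _ _ b) = 0 at h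
  rw [infl_cocycleClass, cupT_cocycleClass, ← map_add] at h
  obtain ⟨i, W, hW⟩ := (TopModuleCat.cls_eq_zero_iff _ _ _).1 h
  -- The twists and cochain maps of M and of `M.toDiscrete` agree definitionally, so the results on
  -- discrete modules apply directly.
  obtain ⟨h₁, h₂⟩ := M.toDiscrete.exists_dC_eq_of_inflC_add_cupC χ k n a.1 b.1 b.2 i W hW
  exact ⟨(TopModuleCat.cls_eq_zero_iff _ _ _).2 h₁, (TopModuleCat.cls_eq_zero_iff _ _ _).2 h₂⟩

lemma exists_infl_add_cupT (M : FpModule.{u} p G) (χ : G →ₜ* ℤ_[p]ˣ) (k : ℤ) (n : ℕ)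
    (z : continuousCohomology (1 + n) (M.laurentTwist χ k)) :
    ∃ x y, M.infl χ k (1 + n) x + M.cupT χ k n y = z := by
  obtain ⟨F, rfl⟩ := TopModuleCat.cls_surjective _ _ z
  obtain ⟨a, b, ha, hb, h⟩ := M.toDiscrete.exists_dC_eq_inflC_add_cupC_sub χ k n F.1 F.2
  refine ⟨cocycleClass _ _ ⟨a, ha⟩, cocycleClass _ _ ⟨b, hb⟩, ?_⟩
  rw [infl_cocycleClass, cupT_cocycleClass, ← map_add]
  exact (cocycleClass_eq_iff _ F).2 h

/-- The decomposition `Hⁿ⁺¹(G((t)), M(k)) ≃ Hⁿ⁺¹(G, M(k)) × Hⁿ(G, M(k - 1))`. -/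
noncomputable def laurentEquiv (M : FpModule.{u} p G) (χ : G →ₜ* ℤ_[p]ˣ) (k : ℤ) (n : ℕ) :
    (continuousCohomology (1 + n) (M.twist χ k) × continuousCohomology n (M.twist χ (k - 1))) ≃+
      continuousCohomology (1 + n) (M.laurentTwist χ k) :=
  AddEquiv.ofBijective ((M.infl χ k (1 + n)).coprod (M.cupT χ k n))
    ⟨(injective_iff_map_eq_zero _).2 fun x hx =>
      let ⟨h1, h2⟩ := M.infl_add_cupT_injective χ k n x.1 x.2 hx
      Prod.ext h1 h2,
    fun z => let ⟨x, y, h⟩ := M.exists_infl_add_cupT χ k n z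
      ⟨(x, y), h⟩⟩

/-- The residue map `Hⁿ⁺¹(G((t)), M(k)) → Hⁿ(G, M(k - 1))`. -/
noncomputable def residue (M : FpModule.{u} p G) (χ : G →ₜ* ℤ_[p]ˣ) (k : ℤ) (n : ℕ) :
    continuousCohomology (1 + n) (M.laurentTwist χ k) →+
      continuousCohomology n (M.twist χ (k - 1)) :=
  (AddMonoidHom.snd _ _).comp (M.laurentEquiv χ k n).symm.toAddMonoidHom

lemma residue_infl_add_cupT (M : FpModule.{u} p G) (χ : G →ₜ* ℤ_[p]ˣ) (k : ℤ) (n : ℕ)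
    (x : continuousCohomology (1 + n) (M.twist χ k))
    (y : continuousCohomology n (M.twist χ (k - 1))) :
    M.residue χ k n (M.infl χ k (1 + n) x + M.cupT χ k n y) = y :=
  congrArg Prod.snd ((M.laurentEquiv χ k n).symm_apply_apply (x, y))

end Compact

section Natural

variable {χ : G →ₜ* ℤ_[p]ˣ} {G' : Type u} [Group G'] [TopologicalSpace G'] [IsTopologicalGroup G']
  {χ' : G' →ₜ* ℤ_[p]ˣ} {M : FpModule.{u} p G} {M' : FpModule.{u} p G'}
  (φ : G' →ₜ* G) (hφ : ∀ g, χ (φ g) = χ' g)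
  (f : M.V →ₗ[ZMod p] M'.V) (hf : ∀ g m, f (M.ρ (φ g) m) = M'.ρ g (f m)) (k : ℤ) (n : ℕ)

lemma laurentCohMap_cocycleClass (F : Cocycle (M.laurentTwist χ k) n) :
    laurentCohMap k φ hφ f hf n (cocycleClass _ n F) =
      cocycleClass (M'.laurentTwist χ' k) n (mapCocycle (LaurentExt.map φ hφ)
        (DiscreteFpModule.laurentTwistMap (M := M.toDiscrete) (M' := M'.toDiscrete)
          k φ hφ f hf) n F) :=
  map_cocycleClass (LaurentExt.map φ hφ) (DiscreteFpModule.laurentTwistMap (M := M.toDiscrete)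
    (M' := M'.toDiscrete) k φ hφ f hf) n F

lemma cohMap_cocycleClass (F : Cocycle (M.twist χ k) n) :
    cohMap k φ hφ f hf n (cocycleClass _ n F) =
      cocycleClass (M'.twist χ' k) n (mapCocycle φ
        (DiscreteFpModule.twistMap (M := M.toDiscrete) (M' := M'.toDiscrete) k φ hφ f hf) n F) :=
  map_cocycleClass φ (DiscreteFpModule.twistMap (M := M.toDiscrete)
    (M' := M'.toDiscrete) k φ hφ f hf) n F

lemma laurentCohMap_infl (x : continuousCohomology n (M.twist χ k)) :
    laurentCohMap k φ hφ f hf n (M.infl χ k n x) = M'.infl χ' k n (cohMap k φ hφ f hf n x) := by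
  obtain ⟨F, rfl⟩ := TopModuleCat.cls_surjective _ _ x
  refine (congrArg _ (infl_cocycleClass M χ k n F)).trans
    ((laurentCohMap_cocycleClass φ hφ f hf k n _).trans (Eq.trans ?_
      ((congrArg _ (cohMap_cocycleClass φ hφ f hf k n F)).trans
        (M'.infl_cocycleClass χ' k n _)).symm))
  exact congrArg _ (Subtype.ext (DiscreteFpModule.inflC_natural (M := M.toDiscrete)
    (M' := M'.toDiscrete) k φ hφ f hf n F.1))

lemma laurentCohMap_cupT [CompactSpace G] [CompactSpace G']
    (x : continuousCohomology n (M.twist χ (k - 1))) :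
    laurentCohMap k φ hφ f hf (1 + n) (M.cupT χ k n x) =
      M'.cupT χ' k n (cohMap (k - 1) φ hφ f hf n x) := by
  obtain ⟨F, rfl⟩ := TopModuleCat.cls_surjective _ _ x
  refine (congrArg _ (cupT_cocycleClass M χ k n F)).trans
    ((laurentCohMap_cocycleClass φ hφ f hf k (1 + n) _).trans (Eq.trans ?_
      ((congrArg _ (cohMap_cocycleClass φ hφ f hf (k - 1) n F)).trans
        (M'.cupT_cocycleClass χ' k n _)).symm))
  exact congrArg _ (Subtype.ext (DiscreteFpModule.cupC_natural (M := M.toDiscrete)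
    (M' := M'.toDiscrete) k φ hφ f hf n F.1))

end Natural

end FpModule

end

theorem mainTheorem9 (p : ℕ) [Fact p.Prime] :
    ∃ res : ∀ (P : CyclotomicPair.{u} p) (M : FpModule.{u} p P.G) (k : ℤ) (n : ℕ),
        continuousCohomology (1 + n) (M.laurentTwist P.χ k) →+
          continuousCohomology n (M.twist P.χ (k - 1)),
      (∀ (P : CyclotomicPair.{u} p) (M : FpModule.{u} p P.G) (k : ℤ) (n : ℕ),
        Function.Injective (M.infl P.χ k (1 + n)) ∧
        Function.Exact (M.infl P.χ k (1 + n)) (res P M k n) ∧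
        Function.Surjective (res P M k n) ∧
        ∀ x, res P M k n (M.cupT P.χ k n x) = x) ∧
      ∀ (P P' : CyclotomicPair.{u} p) (φ : P'.G →ₜ* P.G) (hφ : ∀ g, P.χ (φ g) = P'.χ g)
        (M : FpModule.{u} p P.G) (M' : FpModule.{u} p P'.G) (f : M.V →ₗ[ZMod p] M'.V)
        (hf : ∀ g m, f (M.ρ (φ g) m) = M'.ρ g (f m)) (k : ℤ) (n : ℕ)
        (x : continuousCohomology (1 + n) (M.laurentTwist P.χ k)),
        res P' M' k n (FpModule.laurentCohMap k φ hφ f hf (1 + n) x) =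
          FpModule.cohMap (k - 1) φ hφ f hf n (res P M k n x) := by
  refine ⟨fun P M k n => M.residue P.χ k n, fun P M k n => ?_,
    fun P P' φ hφ M M' f hf k n z => ?_⟩
  · have hcup (x) : M.residue P.χ k n (M.cupT P.χ k n x) = x := by
      have h := M.residue_infl_add_cupT P.χ k n 0 x
      rwa [map_zero, zero_add] at h
    refine ⟨(injective_iff_map_eq_zero _).2 fun x hx => ?_, fun z => ⟨fun hz => ?_, ?_⟩,
      fun x => ⟨_, hcup x⟩, hcup⟩
    · exact (M.infl_add_cupT_injective P.χ k n x 0 (by rw [hx, map_zero, add_zero])).1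
    · obtain ⟨x, y, rfl⟩ := M.exists_infl_add_cupT P.χ k n z
      rw [M.residue_infl_add_cupT] at hz
      exact ⟨x, by rw [hz, map_zero, add_zero]⟩
    · rintro ⟨x, rfl⟩
      have h := M.residue_infl_add_cupT P.χ k n x 0
      rwa [map_zero, add_zero] at h
  -- Induced maps preserve the shape inf(x) + inf(y) ∪ (t), so comparing second coordinates gives
  -- naturality.
  · obtain ⟨x, y, rfl⟩ := M.exists_infl_add_cupT P.χ k n z
    rw [map_add, FpModule.laurentCohMap_infl, FpModule.laurentCohMap_cupT,
      FpModule.residue_infl_add_cupT, FpModule.residue_infl_add_cupT]
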